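/- \textbf{Setup.} Fix integers $0\le m<L$ and a number $\underline p\in(0,1/2)$. For every number $J$ of sessions consider an experiment with $T=JL$ periods, divided into the sessions $\{(j-1)L+1,\dots,jL\}$, $j=1,\dots,J$, with fixed potential outcomes $Y_t(\mathbf w)\in\mathbb R$, $t\le T$, $\mathbf w\in\{0,1\}^T$. They are non-anticipating ($Y_t(\mathbf w)$ depends only on $w_1,\dots,w_t$) and have $m$-carryover (for $t\ge m+1$, $Y_t(\mathbf w)$ does not depend on $w_1,\dots,w_{t-m-1}$). Session labels $Z_1,\dots,Z_J$ are independent, $Z_j\sim\mathrm{Bernoulli}(p_j)$ with $\underline p\le p_j\le 1-\underline p$, and every period receives the label of its session; potential outcomes and $p_j$ may depend on $J$. Let $\bar Y_j^{\rm obs}$ be the mean observed outcome over the last $L-m$ periods of session $j$, and let $\bar Y_j(z)$ be the mean potential outcome over these periods under the constant path $(z,\dots,z)$. \textbf{Assumptions.} (i) $\sup_{J\ge1}J^{-1}\sum_{j=1}^J\max\{|\bar Y_j(1)|,|\bar Y_j(0)|\}^4<\infty$. (ii) The empirical measures $J^{-1}\sum_{j=1}^J\delta_{(p_j,\bar Y_j(1),\bar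 Y_j(0))}$ converge weakly, as $J\to\infty$, to a probability measure $\nu$ on $[\underline p,1-\underline p]\times\mathbb R^2$. With $(P,Y_1,Y_0)\sim\nu$, $\mu_1=\mathbb E_\nu[Y_1]$ and $\mu_0=\mathbb E_\nu[Y_0]$, assume (iii) $\mathbb E_\nu\big[\big(\sqrt{(1-P)/P}\,Y_1+\sqrt{P/(1-P)}\,Y_0\big)^2\big]>0$, and (iv) $\sigma_{\rm up,reg}^2:=\mathbb E_\nu\big[(Y_1-\mu_1)^2/P+(Y_0-\mu_0)^2/(1-P)\big]>0$. Put $\sigma_{\rm reg}^2:=\mathbb E_\nu\big[\big(\sqrt{(1-P)/P}\,(Y_1-\mu_1)+\sqrt{P/(1-P)}\,(Y_0-\mu_0)\big)^2\big]$. \textbf{Statistic.} For session values $y_j$ and labels $z_j$ let $\hat\tau_{\rm reg}$ be the slope of the weighted least squares regression of $y_j$ on an intercept and $z_j$ with weights $z_j/p_j+(1-z_j)/(1-p_j)$; it equals $\hat\mu_1-\hat\mu_0$ with \[\hat\mu_1=\frac{\sum_j z_jy_j/p_j}{\sum_j z_j/p_j},\qquad \hat\mu_0=\frac{\sum_j (1-z_j)y_j/(1-p_j)}{\sum_j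 (1-z_j)/(1-p_j)}.\] Its HC0 variance is \[\widehat V_{\rm reg}=\frac{\sum_{j}z_j(y_j-\hat\mu_1)^2/p_j^2}{(\sum_j z_j/p_j)^2}+\frac{\sum_{j}(1-z_j)(y_j-\hat\mu_0)^2/(1-p_j)^2}{(\sum_j (1-z_j)/(1-p_j))^2},\] and $T_{\rm reg}=\hat\tau_{\rm reg}/\sqrt{\widehat V_{\rm reg}}$. (If an arm is empty or the variance vanishes, any fixed convention may be used; here $\hat\tau_{\rm reg}=0$ and $x/0=0$, respectively.) The one-sided Monte Carlo $p$-value $\hat p_{\rm reg}$ with $M_J$ resamples is $(1+\#\{b\le M_J: T^{(b)}\ge T^{\rm obs}\})/(M_J+1)$, where $T^{\rm obs}$ is $T_{\rm reg}$ at $(\bar Y^{\rm obs},Z)$ and $T^{(b)}$ is $T_{\rm reg}$ at $(\bar Y^{\rm obs},Z^{(b)})$, with $Z^{(1)},\dots,Z^{(M_J)}$ independent copies of $Z$, independent of $Z$, and $\bar Y^{\rm obs}$ held fixed. \textbf{Claim.} Suppose that the focal-average weak null $\frac1J\sum_{j=1}^J\{\bar Y_j(1)-\bar Y_j(0)\}=0$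 holds for every $J\ge 1$. Then, for any numbers $M_J$ of resamples (constant or varying with $J$), \[\limsup_{J\to\infty}\mathbb P(\hat p_{\rm reg}\le\alpha)\le\alpha\qquad\text{for all }\alpha\in(0,1/2),\] and, if $\sigma_{\rm reg}^2=\sigma_{\rm up,reg}^2$ (the HC0 variance is asymptotically not conservative), for all $\alpha\in(0,1)$. -/

import Mathlib

open MeasureTheory ProbabilityTheory Filter
open scoped unitInterval ENNReal Topology

noncomputable section

namespace Switchback

/-! ### Potential outcomes

Periods are indexed by `Fin T`, that is, period `t` of `{1, …, T}` has index `t - 1`. -/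

/-- The potential outcome of each period under each assignment path. -/
abbrev PotentialOutcomes (T : ℕ) := Fin T → (Fin T → Bool) → ℝ

/-- Outcomes do not depend on future assignments. -/
def NonAnticipating {T : ℕ} (Y : PotentialOutcomes T) : Prop :=
  ∀ (t : Fin T) (w w' : Fin T → Bool), (∀ s, s ≤ t → w s = w' s) → Y t w = Y t w'

/-- From the `(m+1)`-st period on, outcomes do not depend on assignments more than `m` periods in
the past. -/
def MCarryover {T : ℕ} (m : ℕ) (Y : PotentialOutcomes T) : Prop :=
  ∀ t : Fin T, m ≤ (t : ℕ) → ∀ w w' : Fin T → Bool,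
    (∀ s : Fin T, (t : ℕ) ≤ (s : ℕ) + m → w s = w' s) → Y t w = Y t w'

/-! ### Fixed-length sessions: `T = J * L`, session `j` is `{t | j * L ≤ t < (j + 1) * L}` -/

/-- The assignment path that gives every period the label of its session. -/
def sessionPath {J L : ℕ} (z : Fin J → Bool) : Fin (J * L) → Bool := fun t => z t.divNat

/-- The focal window of session `j`: all its periods but the first `m`. -/
def focalWindow (J L m : ℕ) (j : Fin J) : Finset (Fin (J * L)) :=
  Finset.univ.filter fun t => (j : ℕ) * L + m ≤ (t : ℕ) ∧ (t : ℕ) < ((j : ℕ) + 1) * L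

/-- The mean outcome over the focal window of session `j` under the assignment path `w`. -/
def focalMean {J L : ℕ} (m : ℕ) (Y : PotentialOutcomes (J * L)) (w : Fin (J * L) → Bool)
    (j : Fin J) : ℝ :=
  (∑ t ∈ focalWindow J L m j, Y t w) / ((L : ℝ) - (m : ℝ))

/-- The session-level potential outcome: the focal mean under a constant path. -/
def sessionPO {J L : ℕ} (m : ℕ) (Y : PotentialOutcomes (J * L)) (z : Bool) (j : Fin J) : ℝ :=
  focalMean m Y (fun _ => z) j

/-- The observed focal means when the session labels are `z`. -/
def observedMean {J L : ℕ} (m : ℕ) (Y : PotentialOutcomes (J * L)) (z : Fin J → Bool) :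
    Fin J → ℝ :=
  focalMean m Y (sessionPath z)

/-- The focal-average effect. -/
def focalEffect {J L : ℕ} (m : ℕ) (Y : PotentialOutcomes (J * L)) : ℝ :=
  (∑ j, (sessionPO m Y true j - sessionPO m Y false j)) / (J : ℝ)

/-! ### The regression-based studentized statistic -/

/-- A treatment label as a real number. -/
def ind (b : Bool) : ℝ := if b then 1 else 0

variable {J : ℕ}

/-- The inverse-probability weight of session `j`. -/
def ipw (p : Fin J → I) (z : Fin J → Bool) (j : Fin J) : ℝ :=
  ind (z j) / (p j : ℝ) + (1 - ind (z j)) / (1 - (p j : ℝ))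

/-- The weighted sum of squares at intercept `θ.1` and slope `θ.2`. -/
def wlsObjective (p : Fin J → I) (y : Fin J → ℝ) (z : Fin J → Bool) (θ : ℝ × ℝ) : ℝ :=
  ∑ j, ipw p z j * (y j - θ.1 - θ.2 * ind (z j)) ^ 2

open Classical in
/-- The weighted-least-squares slope of `y` on an intercept and the label, and `0` where the
minimizer is not unique (some arm is empty). -/
def tauReg (p : Fin J → I) (y : Fin J → ℝ) (z : Fin J → Bool) : ℝ :=
  if h : ∃! θ : ℝ × ℝ, ∀ θ' : ℝ × ℝ, wlsObjective p y z θ ≤ wlsObjective p y z θ'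
  then h.choose.2 else 0

/-- The inverse-probability-weighted normalized mean of the treated arm. -/
def muHat1 (p : Fin J → I) (y : Fin J → ℝ) (z : Fin J → Bool) : ℝ :=
  (∑ j, ind (z j) * y j / (p j : ℝ)) / ∑ j, ind (z j) / (p j : ℝ)

/-- The inverse-probability-weighted normalized mean of the control arm. -/
def muHat0 (p : Fin J → I) (y : Fin J → ℝ) (z : Fin J → Bool) : ℝ :=
  (∑ j, (1 - ind (z j)) * y j / (1 - (p j : ℝ))) / ∑ j, (1 - ind (z j)) / (1 - (p j : ℝ))

/-- Completing the square in the weighted sum of squares. -/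
theorem wls_identity (p : Fin J → I) (y : Fin J → ℝ) (z : Fin J → Bool)
    (h1 : (∑ j, ind (z j) / (p j : ℝ)) ≠ 0)
    (h0 : (∑ j, (1 - ind (z j)) / (1 - (p j : ℝ))) ≠ 0) (θ : ℝ × ℝ) :
    wlsObjective p y z θ =
      wlsObjective p y z (muHat0 p y z, muHat1 p y z - muHat0 p y z)
        + (∑ j, ind (z j) / (p j : ℝ)) * (θ.1 + θ.2 - muHat1 p y z) ^ 2
        + (∑ j, (1 - ind (z j)) / (1 - (p j : ℝ))) * (θ.1 - muHat0 p y z) ^ 2 := by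
  have e1 : muHat1 p y z * (∑ j, ind (z j) / (p j : ℝ)) = ∑ j, ind (z j) * y j / (p j : ℝ) := by
    rw [muHat1, div_mul_cancel₀ _ h1]
  have e0 : muHat0 p y z * (∑ j, (1 - ind (z j)) / (1 - (p j : ℝ)))
      = ∑ j, (1 - ind (z j)) * y j / (1 - (p j : ℝ)) := by
    rw [muHat0, div_mul_cancel₀ _ h0]
  have key : ∀ a b : ℝ, wlsObjective p y z (b, a - b) =
      ((∑ j, ind (z j) * y j ^ 2 / (p j : ℝ)) - 2 * a * (∑ j, ind (z j) * y j / (p j : ℝ))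
        + a ^ 2 * (∑ j, ind (z j) / (p j : ℝ)))
      + ((∑ j, (1 - ind (z j)) * y j ^ 2 / (1 - (p j : ℝ)))
        - 2 * b * (∑ j, (1 - ind (z j)) * y j / (1 - (p j : ℝ)))
        + b ^ 2 * (∑ j, (1 - ind (z j)) / (1 - (p j : ℝ)))) := by
    intro a b
    simp only [wlsObjective, Finset.mul_sum, ← Finset.sum_sub_distrib, ← Finset.sum_add_distrib]
    refine Finset.sum_congr rfl fun j _ => ?_
    rcases Bool.eq_false_or_eq_true (z j) with h | h <;> simp [ipw, ind, h] <;> ring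
  have := key (θ.1 + θ.2) θ.1
  rw [show ((θ.1, θ.1 + θ.2 - θ.1) : ℝ × ℝ) = θ by ext <;> simp] at this
  rw [this, key, ← e1, ← e0]
  ring

/-- If both arms are non-empty, the minimizer is unique and the slope is the difference of the
normalized means. -/
theorem tauReg_eq (p : Fin J → I) (y : Fin J → ℝ) (z : Fin J → Bool)
    (h1 : 0 < ∑ j, ind (z j) / (p j : ℝ))
    (h0 : 0 < ∑ j, (1 - ind (z j)) / (1 - (p j : ℝ))) :
    tauReg p y z = muHat1 p y z - muHat0 p y z := by
  have id := wls_identity p y z h1.ne' h0.ne'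
  have hu : ∀ θ : ℝ × ℝ, (∀ θ', wlsObjective p y z θ ≤ wlsObjective p y z θ') →
      θ = (muHat0 p y z, muHat1 p y z - muHat0 p y z) := by
    intro θ hθ
    have h := hθ (muHat0 p y z, muHat1 p y z - muHat0 p y z)
    rw [id θ] at h
    have a := mul_nonneg h1.le (sq_nonneg (θ.1 + θ.2 - muHat1 p y z))
    have b := mul_nonneg h0.le (sq_nonneg (θ.1 - muHat0 p y z))
    have a' : (∑ j, ind (z j) / (p j : ℝ)) * (θ.1 + θ.2 - muHat1 p y z) ^ 2 = 0 := by linarith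
    have b' : (∑ j, (1 - ind (z j)) / (1 - (p j : ℝ))) * (θ.1 - muHat0 p y z) ^ 2 = 0 := by
      linarith
    have a2 := pow_eq_zero_iff (two_ne_zero) |>.1 ((mul_eq_zero.1 a').resolve_left h1.ne')
    have b2 := pow_eq_zero_iff (two_ne_zero) |>.1 ((mul_eq_zero.1 b').resolve_left h0.ne')
    ext <;> simp <;> linarith
  have hex : ∃! θ : ℝ × ℝ, ∀ θ', wlsObjective p y z θ ≤ wlsObjective p y z θ' := by
    refine ⟨_, fun θ' => ?_, hu⟩
    rw [id θ']
    have a := mul_nonneg h1.le (sq_nonneg (θ'.1 + θ'.2 - muHat1 p y z))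
    have b := mul_nonneg h0.le (sq_nonneg (θ'.1 - muHat0 p y z))
    linarith
  rw [tauReg, dif_pos hex, hu _ hex.choose_spec.1]

/-- The heteroskedasticity-robust (HC0) variance of the weighted-least-squares slope. -/
def vReg (p : Fin J → I) (y : Fin J → ℝ) (z : Fin J → Bool) : ℝ :=
  (∑ j, ind (z j) * (y j - muHat1 p y z) ^ 2 / (p j : ℝ) ^ 2)
      / (∑ j, ind (z j) / (p j : ℝ)) ^ 2
    + (∑ j, (1 - ind (z j)) * (y j - muHat0 p y z) ^ 2 / (1 - (p j : ℝ)) ^ 2)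
      / (∑ j, (1 - ind (z j)) / (1 - (p j : ℝ))) ^ 2

/-- The studentized statistic. -/
def tReg (p : Fin J → I) (y : Fin J → ℝ) (z : Fin J → Bool) : ℝ :=
  tauReg p y z / √(vReg p y z)

/-! ### The Monte Carlo conditional randomization test -/

/-- Independent session labels, the `j`-th one Bernoulli with success probability `p j`. -/
def designLaw (p : Fin J → I) : Measure (Fin J → Bool) :=
  Measure.pi fun j => bernoulliMeasure true false (p j)

/-- The joint law of the realized labels and of `M` independent resampled label vectors. -/
def monteCarloLaw (M : ℕ) (p : Fin J → I) :
    Measure ((Fin J → Bool) × (Fin M → Fin J → Bool)) :=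
  (designLaw p).prod (Measure.pi fun _ => designLaw p)

open Classical in
/-- The one-sided Monte Carlo `p`-value with realized labels `z` and resampled labels `zs`; the
observed focal means are held fixed when the statistic is recomputed. -/
def pValue {L M : ℕ} (m : ℕ) (p : Fin J → I) (Y : PotentialOutcomes (J * L))
    (z : Fin J → Bool) (zs : Fin M → Fin J → Bool) : ℝ :=
  (((Finset.univ.filter fun b : Fin M =>
      tReg p (observedMean m Y z) (zs b) ≥ tReg p (observedMean m Y z) z).card : ℝ) + 1)
    / ((M : ℝ) + 1)

/-! ### Asymptotic assumptions -/

/-- The empirical measure of `(p j, Ȳ j (1), Ȳ j (0))` over the sessions. -/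
def empiricalMeasure {L : ℕ} (m : ℕ) (p : Fin J → I) (Y : PotentialOutcomes (J * L)) :
    Measure (ℝ × ℝ × ℝ) :=
  (J : ℝ≥0∞)⁻¹ •
    ∑ j, Measure.dirac ((p j : ℝ), sessionPO m Y true j, sessionPO m Y false j)

/-- `σ_S²` for the limit law `ν` of `(P, Y₁, Y₀)`. -/
def sigmaS (ν : Measure (ℝ × ℝ × ℝ)) : ℝ :=
  ∫ x, (√((1 - x.1) / x.1) * x.2.1 + √(x.1 / (1 - x.1)) * x.2.2) ^ 2 ∂ν

/-- `μ₁ = E[Y₁]`. -/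
def mean1 (ν : Measure (ℝ × ℝ × ℝ)) : ℝ := ∫ x, x.2.1 ∂ν

/-- `μ₀ = E[Y₀]`. -/
def mean0 (ν : Measure (ℝ × ℝ × ℝ)) : ℝ := ∫ x, x.2.2 ∂ν

/-- `σ_reg²`, the limit of the variance of `√J` times the regression coefficient. -/
def sigmaReg (ν : Measure (ℝ × ℝ × ℝ)) : ℝ :=
  ∫ x, (√((1 - x.1) / x.1) * (x.2.1 - mean1 ν) + √(x.1 / (1 - x.1)) * (x.2.2 - mean0 ν)) ^ 2 ∂ν

/-- `σ_{up,reg}²`, the limit of `J` times the HC0 variance. -/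
def sigmaUpReg (ν : Measure (ℝ × ℝ × ℝ)) : ℝ :=
  ∫ x, ((x.2.1 - mean1 ν) ^ 2 / x.1 + (x.2.2 - mean0 ν) ^ 2 / (1 - x.1)) ∂ν

/-- The weak-null asymptotics under fixed-length sessions, for one experiment with `J` sessions
for every `J`. -/
structure WeakNullAsymptotics (L m : ℕ) (pmin : ℝ) (p : (J : ℕ) → Fin J → I)
    (Y : (J : ℕ) → PotentialOutcomes (J * L)) (ν : Measure (ℝ × ℝ × ℝ)) : Prop where
  carryover_lt : m < L
  pmin_pos : 0 < pmin
  pmin_lt : pmin < 1 / 2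
  overlap : ∀ (J : ℕ) (j : Fin J), pmin ≤ (p J j : ℝ) ∧ (p J j : ℝ) ≤ 1 - pmin
  fourth_moment : ∃ C : ℝ, ∀ J : ℕ, 1 ≤ J →
    (∑ j, (max |sessionPO m (Y J) true j| |sessionPO m (Y J) false j|) ^ 4) / (J : ℝ) ≤ C
  limit_prob : IsProbabilityMeasure ν
  limit_support : ∀ᵐ x ∂ν, pmin ≤ x.1 ∧ x.1 ≤ 1 - pmin
  stabilization : ∀ f : BoundedContinuousFunction (ℝ × ℝ × ℝ) ℝ,
    Tendsto (fun J : ℕ => ∫ x, f x ∂(empiricalMeasure m (p J) (Y J))) atTop (𝓝 (∫ x, f x ∂ν))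
  nondegenerate : 0 < sigmaS ν

end Switchback

end

/-! Given the realized labels, every resampled statistic reaches the observed one with the same
probability `q` (`tailProb`). The number of exceedances is therefore binomial, and the rejection
probability is the expectation of a binomial lower tail at the random point `q`
(`monteCarloLaw_pValue_le`). What matters is the limit law of `q`.

The carryover conditions reduce the data to two values per session, one of which the label reveals
(`observedMean_eq`). Under the weak null both arms have the same mean, and one central limit theorem
for the studentized statistic (`tendstoInDistribution_tReg`) serves twice. For the actual labels the
limit is a centred Gaussian of variance `r² = σ_reg² / σ_{up,reg}² ≤ 1`: HC0 overstates the variance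
by the mean square of `Y₁ - Y₀`. For resampled labels the outcomes are frozen, both arms hold the
same values, the excess disappears and the limit is standard Gaussian, uniformly over outcomes with
controlled moments. Hence `q` converges in law to `gaussianTail (r * G)` with `G` standard Gaussian.

If `r = 1`, this limit is uniform, and the binomial lower tail below `k = ⌊α (M + 1)⌋` integrates to
`k / (M + 1) ≤ α`. If `r < 1`, the limit is symmetric about `1/2` and more concentrated there, which
lowers the expectation of any function whose symmetrization decreases on `[0, 1/2]`
(`integral_comp_gaussianTail_mul_le`). The binomial lower tail is such a function when `2 k ≤ M +
1`, and `α < 1/2` ensures this. For arbitrary `M_J`, the finitely many small values are handled one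
at a time; for large ones Chebyshev's inequality bounds the binomial tail by a continuous ramp free
of `M`. -/

namespace Switchback

/-! ### Convergence in probability along varying probability spaces. -/

section InProbability

variable {Ω : ℕ → Type*} [∀ n, MeasurableSpace (Ω n)]

/-- Convergence in probability to a constant of random elements that may be defined on different
spaces. -/
def TendstoInProb {E : Type*} [PseudoMetricSpace E] (μ : ∀ n, Measure (Ω n))
    (X : ∀ n, Ω n → E) (c : E) : Prop :=
  ∀ ε : ℝ, 0 < ε → Tendsto (fun n => μ n {x | ε ≤ dist (X n x) c}) atTop (𝓝 0)

variable {E F : Type*} [PseudoMetricSpace E] [PseudoMetricSpace F] {μ : ∀ n, Measure (Ω n)}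

theorem TendstoInProb.comp_continuousAt {X : ∀ n, Ω n → E} {c : E} (hX : TendstoInProb μ X c)
    {g : E → F} (hg : ContinuousAt g c) : TendstoInProb μ (fun n x => g (X n x)) (g c) := by
  intro ε hε
  obtain ⟨δ, hδ, h⟩ := Metric.continuousAt_iff.1 hg ε hε
  refine tendsto_of_tendsto_of_tendsto_of_le_of_le tendsto_const_nhds (hX δ hδ)
    (fun _ => zero_le) fun n => measure_mono fun x hx => ?_
  by_contra hc
  exact absurd (h (not_le.1 hc)) (not_lt.2 hx)

theorem TendstoInProb.prodMk {X : ∀ n, Ω n → E} {Y : ∀ n, Ω n → F} {c : E} {d : F}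
    (hX : TendstoInProb μ X c) (hY : TendstoInProb μ Y d) :
    TendstoInProb μ (fun n x => (X n x, Y n x)) (c, d) := by
  intro ε hε
  have h := (hX ε hε).add (hY ε hε)
  rw [add_zero] at h
  refine tendsto_of_tendsto_of_tendsto_of_le_of_le tendsto_const_nhds h
    (fun _ => zero_le) fun n => (measure_mono fun x hx => ?_).trans (measure_union_le _ _)
  simpa [Prod.dist_eq] using hx

theorem tendstoInProb_const {c : ℕ → E} {d : E} (h : Tendsto c atTop (𝓝 d))
    (μ : ∀ n, Measure (Ω n)) : TendstoInProb μ (fun n _ => c n) d := by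
  intro ε hε
  refine tendsto_const_nhds.congr' ?_
  filter_upwards [(Metric.tendsto_nhds.1 h) ε hε] with n hn
  simp [not_le.2 hn]

theorem TendstoInProb.congr {X Y : ∀ n, Ω n → E} {c : E} (hX : TendstoInProb μ X c)
    (h : Tendsto (fun n => μ n {x | X n x ≠ Y n x}) atTop (𝓝 0)) : TendstoInProb μ Y c := by
  intro ε hε
  have h' := (hX ε hε).add h
  rw [add_zero] at h'
  refine tendsto_of_tendsto_of_tendsto_of_le_of_le tendsto_const_nhds h'
    (fun _ => zero_le) fun n => (measure_mono fun x hx => ?_).trans (measure_union_le _ _)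
  by_cases e : X n x = Y n x
  · left; simpa [e] using hx
  · right; exact e

theorem TendstoInProb.congr_eventually {X Y : ∀ n, Ω n → E} {c : E} (hX : TendstoInProb μ X c)
    (h : ∀ᶠ n in atTop, X n = Y n) : TendstoInProb μ Y c := by
  refine hX.congr (tendsto_const_nhds.congr' ?_)
  filter_upwards [h] with n hn
  simp [hn]

theorem TendstoInProb.add {X Y : ∀ n, Ω n → ℝ} {c d : ℝ} (hX : TendstoInProb μ X c)
    (hY : TendstoInProb μ Y d) : TendstoInProb μ (fun n x => X n x + Y n x) (c + d) :=
  (hX.prodMk hY).comp_continuousAt (g := fun q : ℝ × ℝ => q.1 + q.2) (by fun_prop)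

theorem TendstoInProb.sub {X Y : ∀ n, Ω n → ℝ} {c d : ℝ} (hX : TendstoInProb μ X c)
    (hY : TendstoInProb μ Y d) : TendstoInProb μ (fun n x => X n x - Y n x) (c - d) :=
  (hX.prodMk hY).comp_continuousAt (g := fun q : ℝ × ℝ => q.1 - q.2) (by fun_prop)

theorem TendstoInProb.mul {X Y : ∀ n, Ω n → ℝ} {c d : ℝ} (hX : TendstoInProb μ X c)
    (hY : TendstoInProb μ Y d) : TendstoInProb μ (fun n x => X n x * Y n x) (c * d) :=
  (hX.prodMk hY).comp_continuousAt (g := fun q : ℝ × ℝ => q.1 * q.2) (by fun_prop)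

/-- Serves the cross terms of the HC0 variance: the second factor is only bounded, so its limit need
not be identified. -/
theorem TendstoInProb.mul_bounded {X Y : ∀ n, Ω n → ℝ} (hX : TendstoInProb μ X 0) {K : ℝ}
    (hY : ∀ᶠ n in atTop, ∀ x, |Y n x| ≤ K) : TendstoInProb μ (fun n x => X n x * Y n x) 0 := by
  intro ε hε
  have hK : 0 < |K| + 1 := by positivity
  refine tendsto_of_tendsto_of_tendsto_of_le_of_le' tendsto_const_nhds (hX (ε / (|K| + 1))
    (by positivity)) (Eventually.of_forall fun _ => zero_le) ?_
  filter_upwards [hY] with n hn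
  refine measure_mono fun x hx => ?_
  simp only [Set.mem_ofPred_eq, dist_zero_right, Real.norm_eq_abs, abs_mul] at hx ⊢
  rw [div_le_iff₀ hK]
  refine hx.trans (mul_le_mul_of_nonneg_left ?_ (abs_nonneg _))
  linarith [hn x, le_abs_self K]

theorem tendstoInProb_zero_of_integral_abs [∀ n, IsProbabilityMeasure (μ n)] [∀ n, Finite (Ω n)]
    [∀ n, DiscreteMeasurableSpace (Ω n)] {X : ∀ n, Ω n → ℝ} {b : ℕ → ℝ}
    (hb : Tendsto b atTop (𝓝 0)) (h : ∀ᶠ n in atTop, ∫ x, |X n x| ∂(μ n) ≤ b n) :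
    TendstoInProb μ X 0 := by
  intro ε hε
  have hb' : Tendsto (fun n => ENNReal.ofReal (b n / ε)) atTop (𝓝 0) := by
    have := (ENNReal.continuous_ofReal.tendsto 0).comp (by simpa using hb.div_const ε)
    simpa [Function.comp_def] using this
  refine tendsto_of_tendsto_of_tendsto_of_le_of_le' tendsto_const_nhds hb'
    (Eventually.of_forall fun _ => zero_le) ?_
  filter_upwards [h] with n hn
  have hm := mul_meas_ge_le_integral_of_nonneg (μ := μ n) (f := fun x => |X n x|)
    (Eventually.of_forall fun x => abs_nonneg _) (Integrable.of_finite) ε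
  rw [← ENNReal.ofReal_toReal (measure_ne_top (μ n) {x | ε ≤ dist (X n x) 0})]
  refine ENNReal.ofReal_le_ofReal ?_
  rw [le_div_iff₀ hε, mul_comm]
  simpa [measureReal_def] using hm.trans hn

theorem tendstoInProb_zero_of_integral_sq [∀ n, IsProbabilityMeasure (μ n)] [∀ n, Finite (Ω n)]
    [∀ n, DiscreteMeasurableSpace (Ω n)] {X : ∀ n, Ω n → ℝ} {b : ℕ → ℝ}
    (hb : Tendsto b atTop (𝓝 0)) (h : ∀ᶠ n in atTop, ∫ x, X n x ^ 2 ∂(μ n) ≤ b n) :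
    TendstoInProb μ X 0 := by
  have h2 : TendstoInProb μ (fun n x => X n x ^ 2) 0 :=
    tendstoInProb_zero_of_integral_abs hb (by simpa using h)
  intro ε hε
  convert h2 (ε ^ 2) (by positivity) using 5 with n x
  simp [sq_le_sq, abs_of_pos hε]

/-- The infinite product carries all experiments at once. Each event concerns a single coordinate,
so its probability is unchanged. -/
theorem TendstoInProb.tendstoInMeasure [∀ n, IsProbabilityMeasure (μ n)]
    [∀ n, DiscreteMeasurableSpace (Ω n)] {X : ∀ n, Ω n → E} {c : E} (h : TendstoInProb μ X c) :
    TendstoInMeasure (Measure.infinitePi μ) (fun n ω => X n (ω n)) atTop (fun _ => c) := by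
  rw [tendstoInMeasure_iff_dist]
  intro ε hε
  refine (h ε hε).congr fun n => ?_
  rw [← (measurePreserving_eval_infinitePi μ n).measure_preimage
    (MeasurableSet.of_discrete).nullMeasurableSet]
  rfl

end InProbability

/-! ### Slutsky's theorem along varying probability spaces. -/

section Slutsky

variable {Ω : ℕ → Type*} [∀ n, MeasurableSpace (Ω n)] {μ : ∀ n, Measure (Ω n)}
  [∀ n, IsProbabilityMeasure (μ n)] {Ω' : Type*} [MeasurableSpace Ω'] {μ' : Measure Ω'}
  [IsProbabilityMeasure μ']
  {E : Type*} [NormedAddCommGroup E] [SecondCountableTopology E] [MeasurableSpace E] [BorelSpace E]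

/-- Convergence in distribution sees only the individual laws, and the `n`-th coordinate of the
product has law `μ n`. -/
theorem tendstoInDistribution_infinitePi_iff {F : Type*} [TopologicalSpace F] [MeasurableSpace F]
    [OpensMeasurableSpace F] [∀ n, DiscreteMeasurableSpace (Ω n)] {X : ∀ n, Ω n → F} {Z : Ω' → F} :
    TendstoInDistribution (fun n (ω : ∀ n, Ω n) => X n (ω n)) atTop Z
      (fun _ => Measure.infinitePi μ) μ' ↔ TendstoInDistribution X atTop Z μ μ' := by
  have hX : ∀ n, Measurable (X n) := fun n => .of_discrete
  have hX' : ∀ n, Measurable (fun ω : ∀ n, Ω n => X n (ω n)) :=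
    fun n => (hX n).comp (measurable_pi_apply n)
  have key : ∀ n, (Measure.infinitePi μ).map (fun ω : ∀ n, Ω n => X n (ω n)) = (μ n).map (X n) := by
    intro n
    rw [← (measurePreserving_eval_infinitePi μ n).map_eq, Measure.map_map (hX n)
      (measurable_pi_apply n)]
    rfl
  constructor
  · intro h
    refine ⟨fun n => (hX n).aemeasurable, h.aemeasurable_limit, ?_⟩
    refine h.tendsto.congr fun n => Subtype.ext ?_
    exact key n
  · intro h
    refine ⟨fun n => (hX' n).aemeasurable, h.aemeasurable_limit, ?_⟩
    refine h.tendsto.congr fun n => Subtype.ext ?_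
    exact (key n).symm

/-- Slutsky's theorem for random elements that may be defined on different spaces. -/
theorem TendstoInDistribution.slutsky {G F : Type*} [NormedAddCommGroup G]
    [SecondCountableTopology G] [MeasurableSpace G] [BorelSpace G] [TopologicalSpace F]
    [MeasurableSpace F] [BorelSpace F] [∀ n, DiscreteMeasurableSpace (Ω n)]
    {X : ∀ n, Ω n → E} {Y : ∀ n, Ω n → G} {Z : Ω' → E} {c : G}
    (hX : TendstoInDistribution X atTop Z μ μ') (hY : TendstoInProb μ Y c)
    {g : E × G → F} (hg : Continuous g) :
    TendstoInDistribution (fun n x => g (X n x, Y n x)) atTop (fun x => g (Z x, c)) μ μ' := by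
  have h :=
    (tendstoInDistribution_infinitePi_iff.2 hX).continuous_comp_prodMk_of_tendstoInMeasure_const
    hg hY.tendstoInMeasure fun n =>
      ((Measurable.of_discrete (f := Y n)).comp (measurable_pi_apply n)).aemeasurable
  exact tendstoInDistribution_infinitePi_iff.1 h

theorem TendstoInDistribution.congr_prob [∀ n, DiscreteMeasurableSpace (Ω n)]
    {X Y : ∀ n, Ω n → E} {Z : Ω' → E}
    (hX : TendstoInDistribution X atTop Z μ μ')
    (hY : TendstoInProb μ (fun n x => Y n x - X n x) 0) :
    TendstoInDistribution Y atTop Z μ μ' := by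
  have h := TendstoInDistribution.slutsky hX hY (g := fun q : E × E => q.1 + q.2) (by fun_prop)
  simpa using h

end Slutsky

/-! ### Second moments of centred label sums. -/

section Design

variable {N : ℕ}

instance isProbabilityMeasure_designLaw (p : Fin N → I) : IsProbabilityMeasure (designLaw p) := by
  unfold designLaw; infer_instance

/-- The weighted sum of the centred labels. -/
noncomputable def centeredSum (p : Fin N → I) (k : Fin N → ℝ) (z : Fin N → Bool) : ℝ :=
  ∑ j, (ind (z j) - (p j : ℝ)) * k j

theorem integral_bernoulli_label {E : Type*} [NormedAddCommGroup E] [NormedSpace ℝ E]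
    [CompleteSpace E] (q : I) (f : Bool → E) :
    ∫ b, f b ∂(bernoulliMeasure true false q) = (q : ℝ) • f true + (1 - (q : ℝ)) • f false := by
  rw [integral_fintype Integrable.of_finite]
  simp

theorem integral_centeredSum_sq (p : Fin N → I) (k : Fin N → ℝ) :
    ∫ z, centeredSum p k z ^ 2 ∂(designLaw p) = ∑ j, (p j : ℝ) * (1 - p j) * k j ^ 2 := by
  have h0 : ∫ z, centeredSum p k z ∂(designLaw p) = 0 := by
    unfold centeredSum
    rw [integral_finsetSum _ fun _ _ => Integrable.of_finite]
    refine Finset.sum_eq_zero fun j _ => ?_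
    have := integral_comp_eval (μ := fun j => bernoulliMeasure true false (p j)) (i := j)
      (f := fun b => (ind b - (p j : ℝ)) * k j) (by fun_prop)
    rw [designLaw, this, integral_bernoulli_label]
    simp [ind]; ring
  have hv := variance_sum_pi (μ := fun j => bernoulliMeasure true false (p j))
    (X := fun j b => (ind b - (p j : ℝ)) * k j) fun j => MemLp.of_discrete
  have e : (∑ j, fun z : Fin N → Bool => (ind (z j) - (p j : ℝ)) * k j) = centeredSum p k := by
    ext z; simp [centeredSum]
  rw [e, ← designLaw, variance_of_integral_eq_zero (Measurable.of_discrete).aemeasurable h0] at hv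
  rw [hv]
  refine Finset.sum_congr rfl fun j _ => ?_
  rw [variance_of_integral_eq_zero (Measurable.of_discrete).aemeasurable, integral_bernoulli_label]
  · simp [ind]; ring
  · rw [integral_bernoulli_label]; simp [ind]; ring

end Design

/-! ### Characteristic function estimates for a centred Bernoulli variable. -/

section CharFun

/-- The factors are exchanged one at a time; the untouched ones have norm at most one and do not
amplify the error. -/
theorem norm_prod_sub_prod_le_sum {ι : Type*} (s : Finset ι) (a b : ι → ℂ)
    (ha : ∀ i ∈ s, ‖a i‖ ≤ 1) (hb : ∀ i ∈ s, ‖b i‖ ≤ 1) :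
    ‖∏ i ∈ s, a i - ∏ i ∈ s, b i‖ ≤ ∑ i ∈ s, ‖a i - b i‖ := by
  classical
  induction s using Finset.induction_on with
  | empty => simp
  | insert i s hi ih =>
    rw [Finset.prod_insert hi, Finset.prod_insert hi, Finset.sum_insert hi]
    have e : a i * ∏ j ∈ s, a j - b i * ∏ j ∈ s, b j
        = (a i - b i) * ∏ j ∈ s, a j + b i * (∏ j ∈ s, a j - ∏ j ∈ s, b j) := by ring
    rw [e]
    refine (norm_add_le _ _).trans (add_le_add ?_ ?_)
    · rw [norm_mul, norm_prod]
      refine mul_le_of_le_one_right (norm_nonneg _) (Finset.prod_le_one (fun _ _ => norm_nonneg _)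
        fun j hj => ha j (Finset.mem_insert_of_mem hj))
    · rw [norm_mul]
      refine (mul_le_of_le_one_left (norm_nonneg _) (hb i (Finset.mem_insert_self _ _))).trans ?_
      exact ih (fun j hj => ha j (Finset.mem_insert_of_mem hj))
        fun j hj => hb j (Finset.mem_insert_of_mem hj)

/-- For `|u| ≤ 1` the Taylor remainder carries the factor `e < 4`; for `|u| ≥ 1` every term is
bounded separately by a multiple of `|u| ^ 3`, in total `7/2`. -/
theorem norm_exp_mul_I_sub_taylor_le (u : ℝ) :
    ‖Complex.exp (u * Complex.I) - (1 + u * Complex.I - u ^ 2 / 2)‖ ≤ 4 * |u| ^ 3 := by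
  rcases le_total |u| 1 with h | h
  · have := Complex.norm_exp_sub_sum_le_norm_mul_exp (u * Complex.I) 3
    simp only [Finset.sum_range_succ, Finset.sum_range_zero, norm_mul, Complex.norm_real,
      Complex.norm_I, mul_one, Real.norm_eq_abs, mul_pow, Complex.I_sq] at this
    refine (le_of_eq ?_).trans (this.trans ?_)
    · congr 1
      simp [Nat.factorial]; ring
    · rw [mul_comm]
      refine mul_le_mul_of_nonneg_right ?_ (by positivity)
      have := Real.exp_one_lt_d9
      have h2 := Real.exp_le_exp.2 h
      linarith
  · have h1 : ‖Complex.exp (u * Complex.I)‖ = 1 := Complex.norm_exp_ofReal_mul_I u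
    have h2 : ‖(1 + u * Complex.I - u ^ 2 / 2 : ℂ)‖ ≤ 1 + |u| + |u| ^ 2 / 2 := by
      refine (norm_sub_le _ _).trans (add_le_add ((norm_add_le _ _).trans ?_) ?_) <;> simp
    refine (norm_sub_le _ _).trans ?_
    rw [h1]
    have h3 : |u| ≤ |u| ^ 3 := le_self_pow₀ h (by norm_num)
    have h4 : |u| ^ 2 ≤ |u| ^ 3 := pow_le_pow_right₀ h (by norm_num)
    linarith

theorem abs_exp_neg_sub_le {x : ℝ} (hx : 0 ≤ x) : |Real.exp (-x) - (1 - x)| ≤ x ^ 2 := by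
  rcases le_total x 1 with h | h
  · have := Real.abs_exp_sub_one_sub_id_le (x := -x) (by rwa [abs_neg, abs_of_nonneg hx])
    rw [neg_sq] at this
    convert this using 2; ring
  · have h1 : Real.exp (-x) ≤ 1 := Real.exp_le_one_iff.2 (by linarith)
    have h2 := Real.exp_pos (-x)
    rw [abs_le]
    constructor <;> nlinarith

/-- The mean is zero, so the linear terms cancel, and the quadratic ones combine to the variance `q
(1 - q)`, matching the expansion of the Gaussian factor. Only remainders are left. -/
theorem norm_bernoulli_charFun_sub_le {q : ℝ} (h0 : 0 ≤ q) (h1 : q ≤ 1) (u : ℝ) :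
    ‖(q * Complex.exp (((1 - q) * u : ℝ) * Complex.I)
        + (1 - q) * Complex.exp ((-q * u : ℝ) * Complex.I))
      - (Real.exp (-(q * (1 - q) * u ^ 2 / 2)) : ℂ)‖ ≤ 4 * |u| ^ 3 + u ^ 4 := by
  have e : (q * Complex.exp (((1 - q) * u : ℝ) * Complex.I)
        + (1 - q) * Complex.exp ((-q * u : ℝ) * Complex.I))
      - (Real.exp (-(q * (1 - q) * u ^ 2 / 2)) : ℂ)
    = q * (Complex.exp (((1 - q) * u : ℝ) * Complex.I)
        - (1 + ((1 - q) * u : ℝ) * Complex.I - ((1 - q) * u : ℝ) ^ 2 / 2))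
      + ((1 - q : ℝ) : ℂ) * (Complex.exp ((-q * u : ℝ) * Complex.I)
        - (1 + (-q * u : ℝ) * Complex.I - (-q * u : ℝ) ^ 2 / 2))
      - ((Real.exp (-(q * (1 - q) * u ^ 2 / 2)) - (1 - q * (1 - q) * u ^ 2 / 2) : ℝ) : ℂ) := by
    push_cast; ring
  rw [e]
  have hq : 0 ≤ q * (1 - q) := mul_nonneg h0 (by linarith)
  have hq1 : q * (1 - q) ≤ 1 := by nlinarith
  refine (norm_sub_le _ _).trans (add_le_add ((norm_add_le _ _).trans ?_) ?_)
  · have b1 := norm_exp_mul_I_sub_taylor_le ((1 - q) * u)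
    have b2 := norm_exp_mul_I_sub_taylor_le (-q * u)
    have c1 : |(1 - q) * u| ^ 3 ≤ |u| ^ 3 := by
      refine pow_le_pow_left₀ (abs_nonneg _) ?_ 3
      rw [abs_mul]
      refine mul_le_of_le_one_left (abs_nonneg _) ?_
      rw [abs_le]; constructor <;> linarith
    have c2 : |-q * u| ^ 3 ≤ |u| ^ 3 := by
      refine pow_le_pow_left₀ (abs_nonneg _) ?_ 3
      rw [abs_mul]
      refine mul_le_of_le_one_left (abs_nonneg _) ?_
      rw [abs_le]; constructor <;> linarith
    rw [norm_mul, norm_mul, Complex.norm_real, Complex.norm_real, Real.norm_of_nonneg h0,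
      Real.norm_of_nonneg (by linarith : 0 ≤ 1 - q)]
    calc _ ≤ q * (4 * |u| ^ 3) + (1 - q) * (4 * |u| ^ 3) :=
          add_le_add (mul_le_mul_of_nonneg_left (b1.trans (by linarith)) h0)
            (mul_le_mul_of_nonneg_left (b2.trans (by linarith)) (by linarith))
      _ = _ := by ring
  · rw [Complex.norm_real, Real.norm_eq_abs]
    refine (abs_exp_neg_sub_le (by positivity)).trans ?_
    have : (q * (1 - q) * u ^ 2 / 2) ^ 2 = (q * (1 - q)) ^ 2 / 4 * u ^ 4 := by ring
    rw [this]
    refine mul_le_of_le_one_left (by positivity) ?_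
    nlinarith

theorem norm_bernoulli_charFun_le {q : ℝ} (h0 : 0 ≤ q) (h1 : q ≤ 1) (u : ℝ) :
    ‖(q * Complex.exp (((1 - q) * u : ℝ) * Complex.I)
        + (1 - q) * Complex.exp ((-q * u : ℝ) * Complex.I))‖ ≤ 1 := by
  refine (norm_add_le _ _).trans ?_
  have e : (1 - q : ℂ) = ((1 - q : ℝ) : ℂ) := by push_cast; rfl
  rw [norm_mul, norm_mul, e, Complex.norm_exp_ofReal_mul_I, Complex.norm_exp_ofReal_mul_I,
    Complex.norm_real, Complex.norm_real, Real.norm_of_nonneg h0,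
      Real.norm_of_nonneg (by linarith : 0 ≤ 1 - q)]
  simp

end CharFun

/-! ### Central limit theorem for weighted label sums, with a quantitative error. -/

section CLT

theorem charFun_map_centeredSum {N : ℕ} (p : Fin N → I) (k : Fin N → ℝ) (s t : ℝ) :
    charFun ((designLaw p).map fun z => s * centeredSum p k z) t
      = ∏ j, ((p j : ℝ) * Complex.exp (((1 - (p j : ℝ)) * (t * s * k j) : ℝ) * Complex.I)
        + (1 - (p j : ℝ)) * Complex.exp ((-(p j : ℝ) * (t * s * k j) : ℝ) * Complex.I)) := by
  rw [charFun_apply_real, integral_map (Measurable.of_discrete).aemeasurable (by fun_prop)]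
  have e : ∀ z : Fin N → Bool, Complex.exp (t * ((s * centeredSum p k z : ℝ) : ℂ) * Complex.I)
      = ∏ j, Complex.exp ((((ind (z j) - (p j : ℝ)) * (t * s * k j) : ℝ) : ℂ) * Complex.I) := by
    intro z
    rw [← Complex.exp_sum, ← Finset.sum_mul]
    congr 2
    rw [← Complex.ofReal_mul, ← Complex.ofReal_sum]
    congr 1
    rw [centeredSum, Finset.mul_sum, Finset.mul_sum]
    exact Finset.sum_congr rfl fun j _ => by ring
  simp_rw [e]
  rw [designLaw, integral_fintype_prod_eq_prod (𝕜 := ℂ) (f := fun j (b : Bool) =>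
    Complex.exp ((((ind b - (p j : ℝ)) * (t * s * k j) : ℝ) : ℂ) * Complex.I))]
  refine Finset.prod_congr rfl fun j _ => ?_
  rw [integral_bernoulli_label]
  simp [ind]

theorem abs_pow_three_le (x : ℝ) : |x| ^ 3 ≤ 1 + x ^ 4 := by
  have h : x ^ 4 = |x| ^ 4 := by rw [Even.pow_abs (by decide)]
  rw [h]
  nlinarith [abs_nonneg x, sq_nonneg (|x| ^ 2 - |x|), sq_nonneg (|x| ^ 2 - 1), sq_nonneg (|x| - 1)]

/-- A Lyapunov bound: with scale `s = N^(-1/2)`, the `N` cubic errors add up to order `s ^ 3 * N =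
N^(-1/2)` and the quartic ones to `N⁻¹`. The fourth moment controls both, through `|x| ^ 3 ≤ 1 + x ^
4`. -/
theorem norm_charFun_centeredSum_sub_le {N : ℕ} (hN : 0 < N) (p : Fin N → I) (k : Fin N → ℝ)
    {C : ℝ} (hC : (∑ j, k j ^ 4) / N ≤ C) (t : ℝ) :
    ‖charFun ((designLaw p).map fun z => (√N)⁻¹ * centeredSum p k z) t
      - (Real.exp (-(t ^ 2 / 2 * ((∑ j, (p j : ℝ) * (1 - p j) * k j ^ 2) / N))) : ℂ)‖
      ≤ 4 * |t| ^ 3 * (1 + C) * (√N)⁻¹ + t ^ 4 * C * (N : ℝ)⁻¹ := by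
  have hN' : (0 : ℝ) < N := by exact_mod_cast hN
  have hs : (√(N : ℝ))⁻¹ ^ 2 = (N : ℝ)⁻¹ := by
    rw [inv_pow, Real.sq_sqrt hN'.le]
  set s := (√(N : ℝ))⁻¹ with hs_def
  have hs0 : 0 ≤ s := by positivity
  -- The Gaussian characteristic function factors over the sessions too, which permits a comparison
  -- factor by factor.
  have e : (Real.exp (-(t ^ 2 / 2 * ((∑ j, (p j : ℝ) * (1 - p j) * k j ^ 2) / N))) : ℂ)
      = ∏ j, (Real.exp (-((p j : ℝ) * (1 - (p j : ℝ)) * (t * s * k j) ^ 2 / 2)) : ℂ) := by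
    rw [← Complex.ofReal_prod, ← Real.exp_sum]
    congr 2
    rw [Finset.sum_neg_distrib, Finset.sum_div, Finset.mul_sum]
    congr 1
    refine Finset.sum_congr rfl fun j _ => ?_
    rw [mul_pow, mul_pow, hs]
    field_simp
  rw [charFun_map_centeredSum, e]
  refine (norm_prod_sub_prod_le_sum _ _ _ (fun j _ => ?_) fun j _ => ?_).trans ?_
  · exact norm_bernoulli_charFun_le (p j).2.1 (p j).2.2 _
  · rw [Complex.norm_real, Real.norm_of_nonneg (Real.exp_pos _).le, Real.exp_le_one_iff]
    have := mul_nonneg (p j).2.1 (sub_nonneg.2 (p j).2.2)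
    have := mul_nonneg this (sq_nonneg (t * s * k j))
    linarith
  · calc _ ≤ ∑ j, (4 * |t * s * k j| ^ 3 + (t * s * k j) ^ 4) :=
          Finset.sum_le_sum fun j _ => norm_bernoulli_charFun_sub_le (p j).2.1 (p j).2.2 _
      _ ≤ ∑ j, (4 * |t| ^ 3 * s ^ 3 * (1 + k j ^ 4) + t ^ 4 * s ^ 4 * k j ^ 4) := by
          refine Finset.sum_le_sum fun j _ => add_le_add ?_ (le_of_eq (by ring))
          rw [abs_mul, abs_mul, abs_of_nonneg hs0, mul_pow, mul_pow, ← mul_assoc, ← mul_assoc]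
          exact mul_le_mul_of_nonneg_left (abs_pow_three_le _) (by positivity)
      _ = 4 * |t| ^ 3 * s ^ 3 * N * (1 + (∑ j, k j ^ 4) / N)
            + t ^ 4 * s ^ 4 * N * ((∑ j, k j ^ 4) / N) := by
          rw [Finset.sum_add_distrib, ← Finset.mul_sum, ← Finset.mul_sum, Finset.sum_add_distrib]
          simp
          field_simp
      _ ≤ 4 * |t| ^ 3 * s ^ 3 * N * (1 + C) + t ^ 4 * s ^ 4 * N * C := by gcongr
      _ = _ := by
          have h3 : s ^ 3 * N = s := by
            rw [pow_succ, hs]; field_simp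
          have h4 : s ^ 4 * N = (N : ℝ)⁻¹ := by
            rw [show s ^ 4 = (s ^ 2) ^ 2 by ring, hs]; field_simp
          rw [mul_assoc _ (s ^ 3), h3, mul_assoc _ (s ^ 4), h4]; ring

/-- A central limit theorem for weighted sums of independent centred Bernoulli labels. -/
theorem tendstoInDistribution_centeredSum {N : ℕ → ℕ} (hN : Tendsto N atTop atTop)
    (p : ∀ n, Fin (N n) → I) (k : ∀ n, Fin (N n) → ℝ) {C : ℝ}
    (hC : ∀ᶠ n in atTop, (∑ j, k n j ^ 4) / (N n : ℝ) ≤ C) {v : NNReal}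
    (hv : Tendsto (fun n => (∑ j, (p n j : ℝ) * (1 - p n j) * k n j ^ 2) / (N n : ℝ))
      atTop (𝓝 v)) :
    TendstoInDistribution (fun n z => (√(N n : ℝ))⁻¹ * centeredSum (p n) (k n) z) atTop id
      (fun n => designLaw (p n)) (gaussianReal 0 v) where
  forall_aemeasurable n := (Measurable.of_discrete).aemeasurable
  aemeasurable_limit := aemeasurable_id
  tendsto := by
    refine ProbabilityMeasure.tendsto_iff_tendsto_charFun.2 fun t => ?_
    have hNr : Tendsto (fun n => (N n : ℝ)) atTop atTop := tendsto_natCast_atTop_atTop.comp hN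
    have hNi : Tendsto (fun n => (N n : ℝ)⁻¹) atTop (𝓝 0) := tendsto_inv_atTop_zero.comp hNr
    have hNs : Tendsto (fun n => (√(N n : ℝ))⁻¹) atTop (𝓝 0) :=
      tendsto_inv_atTop_zero.comp (Real.tendsto_sqrt_atTop.comp hNr)
    have h1 : Tendsto (fun n => (Real.exp (-(t ^ 2 / 2 *
        ((∑ j, (p n j : ℝ) * (1 - p n j) * k n j ^ 2) / (N n : ℝ)))) : ℂ)) atTop
        (𝓝 (Real.exp (-(t ^ 2 / 2 * v)) : ℂ)) :=
      (Complex.continuous_ofReal.tendsto _).comp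
        ((Real.continuous_exp.tendsto _).comp (hv.const_mul _).neg)
    have h2 : Tendsto (fun n => 4 * |t| ^ 3 * (1 + C) * (√(N n : ℝ))⁻¹ + t ^ 4 * C * (N n : ℝ)⁻¹)
        atTop (𝓝 0) := by
      simpa using (hNs.const_mul (4 * |t| ^ 3 * (1 + C))).add (hNi.const_mul (t ^ 4 * C))
    have h3 := squeeze_zero_norm' (f := fun n =>
      charFun ((designLaw (p n)).map fun z => (√(N n : ℝ))⁻¹ * centeredSum (p n) (k n) z) t
      - (Real.exp (-(t ^ 2 / 2 * ((∑ j, (p n j : ℝ) * (1 - p n j) * k n j ^ 2) / (N n : ℝ)))) : ℂ))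
      (by
        filter_upwards [hC, hN.eventually_gt_atTop 0] with n hn hn0
        exact norm_charFun_centeredSum_sub_le hn0 (p n) (k n) hn t) h2
    have h4 := h3.add h1
    simp only [sub_add_cancel, zero_add] at h4
    simp only [ProbabilityMeasure.coe_mk, Measure.map_id, charFun_gaussianReal]
    convert h4 using 2
    push_cast
    congr 1
    ring_nf

end CLT

/-! ### The studentized statistic as a function of arm averages. -/

section Arms

variable {N : ℕ}

/-- The observed values when the arms have values `a` (treated) and `b` (control). -/
def observe (a b : Fin N → ℝ) (z : Fin N → Bool) (j : Fin N) : ℝ := if z j then a j else b j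

/-- The sum of `f` over the treated sessions, divided by the number of all sessions. -/
noncomputable def treatedAvg (f : Fin N → ℝ) (z : Fin N → Bool) : ℝ := (∑ j, ind (z j) * f j) / N

/-- The sum of `f` over the control sessions, divided by the number of all sessions. -/
noncomputable def controlAvg (f : Fin N → ℝ) (z : Fin N → Bool) : ℝ :=
  (∑ j, (1 - ind (z j)) * f j) / N

/-- Separates the fluctuation caused by the labels from the expectation under the design. -/
theorem treatedAvg_eq (p : Fin N → I) (f : Fin N → ℝ) (z : Fin N → Bool) :
    treatedAvg f z = centeredSum p f z / N + (∑ j, (p j : ℝ) * f j) / N := by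
  rw [treatedAvg, centeredSum, ← add_div, ← Finset.sum_add_distrib]
  congr 1
  exact Finset.sum_congr rfl fun j _ => by ring

/-- The control arm fluctuates through the same centred labels with the opposite sign, so in a
difference of arms the two fluctuations add up to a single `centeredSum`. -/
theorem controlAvg_eq (p : Fin N → I) (f : Fin N → ℝ) (z : Fin N → Bool) :
    controlAvg f z = (∑ j, (1 - (p j : ℝ)) * f j) / N - centeredSum p f z / N := by
  rw [controlAvg, centeredSum, ← sub_div, ← Finset.sum_sub_distrib]
  congr 1
  exact Finset.sum_congr rfl fun j _ => by ring

theorem ind_nonneg (b : Bool) : 0 ≤ ind b := by cases b <;> simp [ind]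

theorem ind_le_one (b : Bool) : ind b ≤ 1 := by cases b <;> simp [ind]

theorem abs_treatedAvg_le (f : Fin N → ℝ) (z : Fin N → Bool) :
    |treatedAvg f z| ≤ (∑ j, |f j|) / N := by
  rw [treatedAvg, abs_div, Nat.abs_cast]
  gcongr
  refine (Finset.abs_sum_le_sum_abs _ _).trans (Finset.sum_le_sum fun j _ => ?_)
  rw [abs_mul, abs_of_nonneg (ind_nonneg _)]
  exact mul_le_of_le_one_left (abs_nonneg _) (ind_le_one _)

theorem abs_controlAvg_le (f : Fin N → ℝ) (z : Fin N → Bool) :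
    |controlAvg f z| ≤ (∑ j, |f j|) / N := by
  rw [controlAvg, abs_div, Nat.abs_cast]
  gcongr
  refine (Finset.abs_sum_le_sum_abs _ _).trans (Finset.sum_le_sum fun j _ => ?_)
  rw [abs_mul, abs_of_nonneg (sub_nonneg.2 (ind_le_one _))]
  exact mul_le_of_le_one_left (abs_nonneg _) (by linarith [ind_nonneg (z j)])

/-- The studentized statistic in terms of the arm averages of the centred values. -/
theorem tReg_eq (hN : 0 < N) (p : Fin N → I) (a b : Fin N → ℝ) (c : ℝ) (z : Fin N → Bool)
    {d1 d0 m1 m0 V : ℝ}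
    (hd1 : d1 = treatedAvg (fun j => 1 / (p j : ℝ)) z)
    (hd0 : d0 = controlAvg (fun j => 1 / (1 - (p j : ℝ))) z)
    (hm1 : m1 = treatedAvg (fun j => (a j - c) / (p j : ℝ)) z)
    (hm0 : m0 = controlAvg (fun j => (b j - c) / (1 - (p j : ℝ))) z)
    (hV : V = (treatedAvg (fun j => (a j - c) ^ 2 / (p j : ℝ) ^ 2) z
        - 2 * (m1 / d1 * treatedAvg (fun j => (a j - c) / (p j : ℝ) ^ 2) z)
        + m1 / d1 * (m1 / d1 * treatedAvg (fun j => 1 / (p j : ℝ) ^ 2) z)) / d1 ^ 2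
      + (controlAvg (fun j => (b j - c) ^ 2 / (1 - (p j : ℝ)) ^ 2) z
        - 2 * (m0 / d0 * controlAvg (fun j => (b j - c) / (1 - (p j : ℝ)) ^ 2) z)
        + m0 / d0 * (m0 / d0 * controlAvg (fun j => 1 / (1 - (p j : ℝ)) ^ 2) z)) / d0 ^ 2)
    (h1 : 0 < d1) (h0 : 0 < d0) :
    tReg p (observe a b z) z = √(N : ℝ) * (m1 * d0 - m0 * d1) * (d1 * d0 * √V)⁻¹ := by
  have hNr : (0 : ℝ) < N := by exact_mod_cast hN
  have eD1 : ∑ j, ind (z j) / (p j : ℝ) = N * d1 := by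
    rw [hd1, treatedAvg, mul_div_cancel₀ _ hNr.ne']
    exact Finset.sum_congr rfl fun j _ => by ring
  have eD0 : ∑ j, (1 - ind (z j)) / (1 - (p j : ℝ)) = N * d0 := by
    rw [hd0, controlAvg, mul_div_cancel₀ _ hNr.ne']
    exact Finset.sum_congr rfl fun j _ => by ring
  -- Normalized means commute with shifts, so the common centre `c` cancels in the slope and in all
  -- residuals.
  have eM1 : muHat1 p (observe a b z) z = c + m1 / d1 := by
    have : ∑ j, ind (z j) * observe a b z j / (p j : ℝ) = N * (c * d1 + m1) := by
      rw [hd1, hm1, treatedAvg, treatedAvg, mul_div_assoc', ← add_div, mul_div_cancel₀ _ hNr.ne',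
        Finset.mul_sum, ← Finset.sum_add_distrib]
      refine Finset.sum_congr rfl fun j _ => ?_
      rcases Bool.eq_false_or_eq_true (z j) with h | h <;> simp [observe, ind, h]
      ring
    rw [muHat1, this, eD1, mul_div_mul_left _ _ hNr.ne']
    field_simp
  have eM0 : muHat0 p (observe a b z) z = c + m0 / d0 := by
    have : ∑ j, (1 - ind (z j)) * observe a b z j / (1 - (p j : ℝ)) = N * (c * d0 + m0) := by
      rw [hd0, hm0, controlAvg, controlAvg, mul_div_assoc', ← add_div, mul_div_cancel₀ _ hNr.ne',
        Finset.mul_sum, ← Finset.sum_add_distrib]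
      refine Finset.sum_congr rfl fun j _ => ?_
      rcases Bool.eq_false_or_eq_true (z j) with h | h <;> simp [observe, ind, h]
      ring
    rw [muHat0, this, eD0, mul_div_mul_left _ _ hNr.ne']
    field_simp
  have eV : vReg p (observe a b z) z = V / N := by
    have e1 : ∑ j, ind (z j) * (observe a b z j - (c + m1 / d1)) ^ 2 / (p j : ℝ) ^ 2
        = N * (treatedAvg (fun j => (a j - c) ^ 2 / (p j : ℝ) ^ 2) z
        - 2 * (m1 / d1 * treatedAvg (fun j => (a j - c) / (p j : ℝ) ^ 2) z)
        + m1 / d1 * (m1 / d1 * treatedAvg (fun j => 1 / (p j : ℝ) ^ 2) z)) := by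
      simp only [treatedAvg, mul_div_assoc', ← sub_div, ← add_div]
      rw [mul_div_cancel_left₀ _ hNr.ne']
      simp only [Finset.mul_sum, ← Finset.sum_add_distrib, ← Finset.sum_sub_distrib]
      refine Finset.sum_congr rfl fun j _ => ?_
      rcases Bool.eq_false_or_eq_true (z j) with h | h <;> simp [observe, ind, h]
      ring
    have e0 : ∑ j, (1 - ind (z j)) * (observe a b z j - (c + m0 / d0)) ^ 2 / (1 - (p j : ℝ)) ^ 2
        = N * (controlAvg (fun j => (b j - c) ^ 2 / (1 - (p j : ℝ)) ^ 2) z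
        - 2 * (m0 / d0 * controlAvg (fun j => (b j - c) / (1 - (p j : ℝ)) ^ 2) z)
        + m0 / d0 * (m0 / d0 * controlAvg (fun j => 1 / (1 - (p j : ℝ)) ^ 2) z)) := by
      simp only [controlAvg, mul_div_assoc', ← sub_div, ← add_div]
      rw [mul_div_cancel_left₀ _ hNr.ne']
      simp only [Finset.mul_sum, ← Finset.sum_add_distrib, ← Finset.sum_sub_distrib]
      refine Finset.sum_congr rfl fun j _ => ?_
      rcases Bool.eq_false_or_eq_true (z j) with h | h <;> simp [observe, ind, h]
      ring
    rw [vReg, eM1, eM0, e1, e0, eD1, eD0, hV]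
    field_simp
  rw [tReg, tauReg_eq p _ z (by rw [eD1]; positivity) (by rw [eD0]; positivity), eM1, eM0, eV,
    Real.sqrt_div' _ hNr.le]
  -- If the variance vanishes, both sides are `0` by the convention for division by zero.
  rcases eq_or_ne (√V) 0 with h | h
  · simp [h]
  · field_simp
    ring

end Arms

/-! ### Laws of large numbers for the arm averages. -/

section LargeNumbers

variable {N : ℕ → ℕ} {p : ∀ n, Fin (N n) → I}

theorem integral_centeredSum_div_sq_le {n : ℕ} (q : Fin n → I) (k : Fin n → ℝ) {K : ℝ}
    (hK : (∑ j, k j ^ 2) / (n : ℝ) ≤ K) :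
    ∫ z, (centeredSum q k z / n) ^ 2 ∂(designLaw q) ≤ K * (n : ℝ)⁻¹ := by
  simp_rw [div_pow]
  rw [integral_div, integral_centeredSum_sq, sq (n : ℝ), ← div_div, ← div_eq_mul_inv]
  gcongr
  refine le_trans ?_ hK
  gcongr with j
  refine mul_le_of_le_one_left (sq_nonneg _) ?_
  nlinarith [(q j).2.1, (q j).2.2]

theorem tendsto_natCast_inv (hN : Tendsto N atTop atTop) :
    Tendsto (fun n => (N n : ℝ)⁻¹) atTop (𝓝 0) :=
  tendsto_inv_atTop_zero.comp (tendsto_natCast_atTop_atTop.comp hN)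

theorem tendstoInProb_centeredSum_div (hN : Tendsto N atTop atTop) {k : ∀ n, Fin (N n) → ℝ} {K : ℝ}
    (hK : ∀ᶠ n in atTop, (∑ j, k n j ^ 2) / (N n : ℝ) ≤ K) :
    TendstoInProb (fun n => designLaw (p n)) (fun n z => centeredSum (p n) (k n) z / N n) 0 := by
  refine tendstoInProb_zero_of_integral_sq (b := fun n => K * (N n : ℝ)⁻¹)
    (by simpa using (tendsto_natCast_inv hN).const_mul K) ?_
  filter_upwards [hK] with n hn
  exact integral_centeredSum_div_sq_le _ _ hn

/-- The product of two centred averages is negligible at the scale of the square root. -/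
theorem tendstoInProb_sqrt_mul_centeredSum_div_mul (hN : Tendsto N atTop atTop)
    {k l : ∀ n, Fin (N n) → ℝ} {K K' : ℝ}
    (hK : ∀ᶠ n in atTop, (∑ j, k n j ^ 2) / (N n : ℝ) ≤ K)
    (hK' : ∀ᶠ n in atTop, (∑ j, l n j ^ 2) / (N n : ℝ) ≤ K') :
    TendstoInProb (fun n => designLaw (p n)) (fun n z => √(N n : ℝ) *
      (centeredSum (p n) (k n) z / N n * (centeredSum (p n) (l n) z / N n))) 0 := by
  refine tendstoInProb_zero_of_integral_abs (b := fun n => (K + K') * (√(N n : ℝ))⁻¹)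
    (by simpa using (tendsto_inv_atTop_zero.comp (Real.tendsto_sqrt_atTop.comp
      (tendsto_natCast_atTop_atTop.comp hN))).const_mul (K + K')) ?_
  filter_upwards [hK, hK'] with n hn hn'
  set x := centeredSum (p n) (k n)
  set y := centeredSum (p n) (l n)
  -- Since `|x y| ≤ x² + y²`, the first absolute moment is of order `√N * N⁻¹`.
  calc _ ≤ ∫ z, √(N n : ℝ) * ((x z / N n) ^ 2 + (y z / N n) ^ 2) ∂(designLaw (p n)) := by
        refine integral_mono Integrable.of_finite Integrable.of_finite fun z => ?_
        simp only [abs_mul, abs_of_nonneg (Real.sqrt_nonneg _)]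
        refine mul_le_mul_of_nonneg_left ?_ (Real.sqrt_nonneg _)
        rw [← sq_abs (x z / _), ← sq_abs (y z / _)]
        nlinarith [sq_nonneg (|x z / N n| - |y z / N n|), sq_nonneg (|x z / N n|),
          sq_nonneg (|y z / N n|)]
    _ = √(N n : ℝ) * (∫ z, (x z / N n) ^ 2 ∂(designLaw (p n))
          + ∫ z, (y z / N n) ^ 2 ∂(designLaw (p n))) := by
        rw [integral_const_mul, integral_add Integrable.of_finite Integrable.of_finite]
    _ ≤ √(N n : ℝ) * (K * (N n : ℝ)⁻¹ + K' * (N n : ℝ)⁻¹) := by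
        gcongr <;> exact integral_centeredSum_div_sq_le _ _ (by assumption)
    _ = _ := by
        rcases eq_or_ne (N n : ℝ) 0 with h | h
        · simp [h]
        · have : √(N n : ℝ) * (N n : ℝ)⁻¹ = (√(N n : ℝ))⁻¹ := by
            rw [← div_eq_mul_inv, Real.sqrt_div_self']; simp
          rw [← add_mul, mul_left_comm, this]

theorem tendstoInProb_treatedAvg (hN : Tendsto N atTop atTop) {f : ∀ n, Fin (N n) → ℝ} {K l : ℝ}
    (hK : ∀ᶠ n in atTop, (∑ j, f n j ^ 2) / (N n : ℝ) ≤ K)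
    (hl : Tendsto (fun n => (∑ j, (p n j : ℝ) * f n j) / (N n : ℝ)) atTop (𝓝 l)) :
    TendstoInProb (fun n => designLaw (p n)) (fun n z => treatedAvg (f n) z) l := by
  have h := (tendstoInProb_centeredSum_div (p := p) hN hK).add
    (tendstoInProb_const hl fun n => designLaw (p n))
  rw [zero_add] at h
  simpa only [← treatedAvg_eq] using h

theorem tendstoInProb_controlAvg (hN : Tendsto N atTop atTop) {f : ∀ n, Fin (N n) → ℝ} {K l : ℝ}
    (hK : ∀ᶠ n in atTop, (∑ j, f n j ^ 2) / (N n : ℝ) ≤ K)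
    (hl : Tendsto (fun n => (∑ j, (1 - (p n j : ℝ)) * f n j) / (N n : ℝ)) atTop (𝓝 l)) :
    TendstoInProb (fun n => designLaw (p n)) (fun n z => controlAvg (f n) z) l := by
  have h := (tendstoInProb_const hl fun n => designLaw (p n)).sub
    (tendstoInProb_centeredSum_div (p := p) hN hK)
  rw [sub_zero] at h
  simpa only [← controlAvg_eq] using h

end LargeNumbers

/-! ### Asymptotic normality of the studentized statistic for two arrays of arm values. -/

section TRegLimit

theorem sum_div_le_of_forall_le {n : ℕ} {g x : Fin n → ℝ} {A B C : ℝ} (hA : 0 ≤ A) (hB : 0 ≤ B)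
    (hg : ∀ j, g j ≤ A + B * x j ^ 4) (hx : (∑ j, x j ^ 4) / (n : ℝ) ≤ C) :
    (∑ j, g j) / (n : ℝ) ≤ A + B * C := by
  calc _ ≤ (∑ j, (A + B * x j ^ 4)) / (n : ℝ) := by gcongr with j; exact hg j
    _ = A * (n / n) + B * ((∑ j, x j ^ 4) / (n : ℝ)) := by
        rw [Finset.sum_add_distrib, ← Finset.mul_sum]; simp; ring
    -- The quotient `n / n` is `0` for `n = 0`, so only `≤ 1` is available; this uses `0 ≤ A`.
    _ ≤ A * 1 + B * C := by gcongr; exact div_self_le_one _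
    _ = _ := by ring

theorem sq_le_one_add_pow_four (x : ℝ) : x ^ 2 ≤ 1 + x ^ 4 := by nlinarith [sq_nonneg (x ^ 2 - 1)]

theorem abs_le_one_add_pow_four (x : ℝ) : |x| ≤ 1 + x ^ 4 := by
  have h := sq_le_one_add_pow_four x
  nlinarith [sq_nonneg (|x| - 1), sq_abs x, abs_nonneg x, sq_nonneg (x ^ 2 - 1)]

variable {q pm : ℝ}

theorem div_sq_le (hpm : 0 < pm) (hq : pm ≤ q) (x : ℝ) : (x / q) ^ 2 ≤ pm⁻¹ ^ 2 * x ^ 2 := by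
  have := hpm.trans_le hq
  rw [div_eq_mul_inv, mul_pow, mul_comm]
  gcongr

theorem abs_div_sq_le (hpm : 0 < pm) (hq : pm ≤ q) (x : ℝ) : |x / q ^ 2| ≤ pm⁻¹ ^ 2 * |x| := by
  have := hpm.trans_le hq
  rw [abs_div, abs_of_nonneg (sq_nonneg q), div_eq_mul_inv, mul_comm, ← inv_pow]
  gcongr

variable {N : ℕ → ℕ} {p : ∀ n, Fin (N n) → I}

/-- Overlap and one fourth moment bound control everything in the statistic: the first three bounds
feed the Chebyshev argument for the arm averages, the last two bound averages that multiply a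
vanishing factor. -/
theorem moment_bounds {n : ℕ} {x q : Fin n → ℝ} {C : ℝ} (hpm : 0 < pm) (hq : ∀ j, pm ≤ q j)
    (hx : (∑ j, x j ^ 4) / (n : ℝ) ≤ C) :
    (∑ j, (1 / q j) ^ 2) / (n : ℝ) ≤ pm⁻¹ ^ 2 * (1 + C) ∧
    (∑ j, (x j / q j) ^ 2) / (n : ℝ) ≤ pm⁻¹ ^ 2 * (1 + C) ∧
    (∑ j, (x j ^ 2 / q j ^ 2) ^ 2) / (n : ℝ) ≤ pm⁻¹ ^ 4 * (1 + C) ∧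
    (∑ j, |x j / q j ^ 2|) / (n : ℝ) ≤ pm⁻¹ ^ 2 * (1 + C) ∧
    (∑ j, |1 / q j ^ 2|) / (n : ℝ) ≤ pm⁻¹ ^ 2 * (1 + C) := by
  have key : ∀ {g : Fin n → ℝ} {A : ℝ}, 0 ≤ A → (∀ j, g j ≤ A * (1 + x j ^ 4)) →
      (∑ j, g j) / (n : ℝ) ≤ A * (1 + C) := by
    intro g A hA hg
    rw [mul_add, mul_one]
    exact sum_div_le_of_forall_le hA hA (fun j => (hg j).trans (by rw [mul_add, mul_one])) hx
  have h4 : ∀ j, 0 ≤ x j ^ 4 := fun j => by positivity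
  refine ⟨key (by positivity) fun j => ?_, key (by positivity) fun j => ?_,
    key (by positivity) fun j => ?_, key (by positivity) fun j => ?_,
    key (by positivity) fun j => ?_⟩
  · refine (div_sq_le hpm (hq j) 1).trans ?_
    gcongr
    linarith [h4 j]
  · refine (div_sq_le hpm (hq j) _).trans ?_
    gcongr
    exact sq_le_one_add_pow_four _
  · rw [← div_pow, show pm⁻¹ ^ 4 * (1 + x j ^ 4) = pm⁻¹ ^ 4 + (pm⁻¹ ^ 2 * x j ^ 2) ^ 2 by ring]
    have := pow_le_pow_left₀ (sq_nonneg _) (div_sq_le hpm (hq j) (x j)) 2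
    have h : 0 ≤ pm⁻¹ ^ 4 := by positivity
    linarith
  · refine (abs_div_sq_le hpm (hq j) _).trans ?_
    gcongr
    exact abs_le_one_add_pow_four _
  · refine (abs_div_sq_le hpm (hq j) _).trans ?_
    gcongr
    rw [abs_one]
    linarith [h4 j]

/-- The factor `8` comes from applying `(s + t)² ≤ 2 (s² + t²)` twice. -/
theorem arm_weight_pow_four_le {α β r : ℝ} (hpm : 0 < pm) (hq : pm ≤ q) (hr : pm ≤ r) :
    (α / q + β / r) ^ 4 ≤ pm⁻¹ ^ 4 * 8 * (α ^ 4 + β ^ 4) := by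
  have h1 : (α / q) ^ 4 ≤ pm⁻¹ ^ 4 * α ^ 4 := by
    have := pow_le_pow_left₀ (sq_nonneg _) (div_sq_le hpm hq α) 2
    calc _ = ((α / q) ^ 2) ^ 2 := by ring
      _ ≤ _ := this
      _ = _ := by ring
  have h2 : (β / r) ^ 4 ≤ pm⁻¹ ^ 4 * β ^ 4 := by
    have := pow_le_pow_left₀ (sq_nonneg _) (div_sq_le hpm hr β) 2
    calc _ = ((β / r) ^ 2) ^ 2 := by ring
      _ ≤ _ := this
      _ = _ := by ring
  have h3 : (α / q + β / r) ^ 4 ≤ 8 * ((α / q) ^ 4 + (β / r) ^ 4) := by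
    have h := pow_le_pow_left₀ (sq_nonneg _) (add_sq_le (a := α / q) (b := β / r)) 2
    nlinarith [sq_nonneg ((α / q) ^ 2 - (β / r) ^ 2)]
  linarith

theorem TendstoInDistribution.congr_law {Ω : ℕ → Type*} [∀ n, MeasurableSpace (Ω n)]
    {μ : ∀ n, Measure (Ω n)} [∀ n, IsProbabilityMeasure (μ n)] {Ω' Ω'' : Type*}
    [MeasurableSpace Ω'] [MeasurableSpace Ω''] {μ' : Measure Ω'} {μ'' : Measure Ω''}
    [IsProbabilityMeasure μ'] [IsProbabilityMeasure μ''] {X : ∀ n, Ω n → ℝ} {Z : Ω' → ℝ}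
    {Z' : Ω'' → ℝ} (h : TendstoInDistribution X atTop Z μ μ') (hZ' : AEMeasurable Z' μ'')
    (e : μ'.map Z = μ''.map Z') : TendstoInDistribution X atTop Z' μ μ'' where
  forall_aemeasurable := h.forall_aemeasurable
  aemeasurable_limit := hZ'
  tendsto := by
    have e' : (⟨μ''.map Z', Measure.isProbabilityMeasure_map hZ'⟩ : ProbabilityMeasure ℝ)
        = ⟨μ'.map Z, Measure.isProbabilityMeasure_map h.aemeasurable_limit⟩ := Subtype.ext e.symm
    rw [e']
    exact h.tendsto

/-- The statistic has the form `(X + R) * W` only when both arms are non-empty, so agreement is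
asked only up to an event of vanishing probability. -/
theorem TendstoInDistribution.add_mul_gaussian {Ω : ℕ → Type*} [∀ n, MeasurableSpace (Ω n)]
    [∀ n, DiscreteMeasurableSpace (Ω n)] {μ : ∀ n, Measure (Ω n)} [∀ n, IsProbabilityMeasure (μ n)]
    {X R W T : ∀ n, Ω n → ℝ} {v : NNReal} {u : ℝ} (hu : 0 < u)
    (hX : TendstoInDistribution X atTop id μ (gaussianReal 0 v)) (hR : TendstoInProb μ R 0)
    (hW : TendstoInProb μ W (√u)⁻¹)
    (hT : Tendsto (fun n => μ n {x | (X n x + R n x) * W n x ≠ T n x}) atTop (𝓝 0)) :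
    TendstoInDistribution T atTop (fun x => √(v / u) * x) μ (gaussianReal 0 1) := by
  have hg : Continuous (fun q : ℝ × (ℝ × ℝ) => (q.1 + q.2.1) * q.2.2) := by fun_prop
  have hRW := hR.prodMk hW
  have h1 := TendstoInDistribution.slutsky hX hRW hg
  simp only [id, add_zero] at h1
  have h2 : TendstoInDistribution (fun n x => (X n x + R n x) * W n x) atTop
      (fun x => √(v / u) * x) μ (gaussianReal 0 1) := by
    refine TendstoInDistribution.congr_law h1 (by fun_prop) ?_
    rw [gaussianReal_map_mul_const, gaussianReal_map_const_mul]
    congr 1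
    · simp
    · ext
      simp [Real.sq_sqrt hu.le, mul_pow, div_eq_inv_mul]
  have h3 : TendstoInProb μ (fun n x => T n x - (X n x + R n x) * W n x) 0 := by
    refine (tendstoInProb_const (tendsto_const_nhds (x := (0 : ℝ))) μ).congr ?_
    refine hT.congr fun n => ?_
    congr 1
    ext x
    simp [eq_comm (a := (0 : ℝ)), sub_eq_zero, eq_comm (a := T n x)]
  exact TendstoInDistribution.congr_prob h2 h3

set_option maxHeartbeats 400000 in
/-- The studentized statistic is asymptotically a centred Gaussian variable. -/
theorem tendstoInDistribution_tReg (hN : Tendsto N atTop atTop) (hpm : 0 < pm)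
    (hp : ∀ n j, pm ≤ (p n j : ℝ) ∧ (p n j : ℝ) ≤ 1 - pm) {a b : ∀ n, Fin (N n) → ℝ} {c : ℕ → ℝ}
    (ha : ∀ᶠ n in atTop, ∑ j, (a n j - c n) = 0) (hb : ∀ᶠ n in atTop, ∑ j, (b n j - c n) = 0)
    {C : ℝ} (hCa : ∀ᶠ n in atTop, (∑ j, (a n j - c n) ^ 4) / (N n : ℝ) ≤ C)
    (hCb : ∀ᶠ n in atTop, (∑ j, (b n j - c n) ^ 4) / (N n : ℝ) ≤ C) {u1 u0 w : ℝ}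
    (hu1 : Tendsto (fun n => (∑ j, (a n j - c n) ^ 2 / (p n j : ℝ)) / (N n : ℝ)) atTop (𝓝 u1))
    (hu0 : Tendsto (fun n => (∑ j, (b n j - c n) ^ 2 / (1 - (p n j : ℝ))) / (N n : ℝ)) atTop
      (𝓝 u0))
    (hw : Tendsto (fun n => (∑ j, (a n j - b n j) ^ 2) / (N n : ℝ)) atTop (𝓝 w))
    (hu : 0 < u1 + u0) :
    TendstoInDistribution (fun n z => tReg (p n) (observe (a n) (b n) z) z) atTop
      (fun x => √((u1 + u0 - w) / (u1 + u0)) * x) (fun n => designLaw (p n)) (gaussianReal 0 1) := by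
  have hp1 : ∀ n j, (p n j : ℝ) ≠ 0 := fun n j => (hpm.trans_le (hp n j).1).ne'
  have hp0' : ∀ n j, pm ≤ 1 - (p n j : ℝ) := fun n j => by linarith [(hp n j).2]
  have hp0 : ∀ n j, 1 - (p n j : ℝ) ≠ 0 := fun n j => (hpm.trans_le (hp0' n j)).ne'
  have B1 := hCa.mono fun n h => moment_bounds hpm (fun j => (hp n j).1) h
  have B0 := hCb.mono fun n h => moment_bounds hpm (fun j => hp0' n j) h
  have hNpos := hN.eventually_gt_atTop 0
  -- laws of large numbers for the arm averages
  have hd1 : TendstoInProb (fun n => designLaw (p n))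
      (fun n z => treatedAvg (fun j => 1 / (p n j : ℝ)) z) 1 := by
    refine tendstoInProb_treatedAvg hN (B1.mono fun n h => h.1) (tendsto_const_nhds.congr' ?_)
    filter_upwards [hNpos] with n hn
    simp [hp1, hn.ne']
  have hd0 : TendstoInProb (fun n => designLaw (p n))
      (fun n z => controlAvg (fun j => 1 / (1 - (p n j : ℝ))) z) 1 := by
    refine tendstoInProb_controlAvg hN (B0.mono fun n h => h.1) (tendsto_const_nhds.congr' ?_)
    filter_upwards [hNpos] with n hn
    simp [hp0, hn.ne']
  -- The inverse weight cancels the assignment probability, so by centring the design expectation is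
  -- exactly zero.
  have eM1 : ∀ᶠ n in atTop, (∑ j, (p n j : ℝ) * ((a n j - c n) / (p n j : ℝ))) / (N n : ℝ) = 0 := by
    filter_upwards [ha] with n hn
    simp [mul_div_cancel₀ _ (hp1 n _), hn]
  have eM0 : ∀ᶠ n in atTop,
      (∑ j, (1 - (p n j : ℝ)) * ((b n j - c n) / (1 - (p n j : ℝ)))) / (N n : ℝ) = 0 := by
    filter_upwards [hb] with n hn
    simp [mul_div_cancel₀ _ (hp0 n _), hn]
  have hm1 : TendstoInProb (fun n => designLaw (p n))
      (fun n z => treatedAvg (fun j => (a n j - c n) / (p n j : ℝ)) z) 0 :=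
    tendstoInProb_treatedAvg hN (B1.mono fun n h => h.2.1)
      (tendsto_const_nhds.congr' (eM1.mono fun n h => h.symm))
  have hm0 : TendstoInProb (fun n => designLaw (p n))
      (fun n z => controlAvg (fun j => (b n j - c n) / (1 - (p n j : ℝ))) z) 0 :=
    tendstoInProb_controlAvg hN (B0.mono fun n h => h.2.1)
      (tendsto_const_nhds.congr' (eM0.mono fun n h => h.symm))
  have hs1 : TendstoInProb (fun n => designLaw (p n))
      (fun n z => treatedAvg (fun j => (a n j - c n) ^ 2 / (p n j : ℝ) ^ 2) z) u1 := by
    refine tendstoInProb_treatedAvg hN (B1.mono fun n h => h.2.2.1) (hu1.congr fun n => ?_)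
    congr 1
    refine Finset.sum_congr rfl fun j _ => ?_
    have := hp1 n j
    field_simp
  have hs0 : TendstoInProb (fun n => designLaw (p n))
      (fun n z => controlAvg (fun j => (b n j - c n) ^ 2 / (1 - (p n j : ℝ)) ^ 2) z) u0 := by
    refine tendstoInProb_controlAvg hN (B0.mono fun n h => h.2.2.1) (hu0.congr fun n => ?_)
    congr 1
    refine Finset.sum_congr rfl fun j _ => ?_
    have := hp0 n j
    field_simp
  have hr1 := hm1.mul (hd1.comp_continuousAt (g := fun x => x⁻¹) (by fun_prop (disch := norm_num)))
  have hr0 := hm0.mul (hd0.comp_continuousAt (g := fun x => x⁻¹) (by fun_prop (disch := norm_num)))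
  simp only [inv_one, mul_one, ← div_eq_mul_inv] at hr1 hr0
  -- The estimation errors of the arm means tend to zero and take their cross and square terms in
  -- the HC0 variance with them.
  have hc1 := hr1.mul_bounded (B1.mono fun n h z => (abs_treatedAvg_le _ z).trans h.2.2.2.1)
  have hc0 := hr0.mul_bounded (B0.mono fun n h z => (abs_controlAvg_le _ z).trans h.2.2.2.1)
  have he1 := hr1.mul (hr1.mul_bounded
    (B1.mono fun n h z => (abs_treatedAvg_le _ z).trans h.2.2.2.2))
  have he0 := hr0.mul (hr0.mul_bounded
    (B0.mono fun n h z => (abs_controlAvg_le _ z).trans h.2.2.2.2))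
  -- the limit of the denominator
  let V : ∀ n, (Fin (N n) → Bool) → ℝ := fun n z =>
    (treatedAvg (fun j => (a n j - c n) ^ 2 / (p n j : ℝ) ^ 2) z
        - 2 * (treatedAvg (fun j => (a n j - c n) / (p n j : ℝ)) z
            / treatedAvg (fun j => 1 / (p n j : ℝ)) z
            * treatedAvg (fun j => (a n j - c n) / (p n j : ℝ) ^ 2) z)
        + treatedAvg (fun j => (a n j - c n) / (p n j : ℝ)) z
            / treatedAvg (fun j => 1 / (p n j : ℝ)) z
            * (treatedAvg (fun j => (a n j - c n) / (p n j : ℝ)) z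
            / treatedAvg (fun j => 1 / (p n j : ℝ)) z
            * treatedAvg (fun j => 1 / (p n j : ℝ) ^ 2) z))
          / treatedAvg (fun j => 1 / (p n j : ℝ)) z ^ 2
      + (controlAvg (fun j => (b n j - c n) ^ 2 / (1 - (p n j : ℝ)) ^ 2) z
        - 2 * (controlAvg (fun j => (b n j - c n) / (1 - (p n j : ℝ))) z
            / controlAvg (fun j => 1 / (1 - (p n j : ℝ))) z
            * controlAvg (fun j => (b n j - c n) / (1 - (p n j : ℝ)) ^ 2) z)
        + controlAvg (fun j => (b n j - c n) / (1 - (p n j : ℝ))) z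
            / controlAvg (fun j => 1 / (1 - (p n j : ℝ))) z
            * (controlAvg (fun j => (b n j - c n) / (1 - (p n j : ℝ))) z
            / controlAvg (fun j => 1 / (1 - (p n j : ℝ))) z
            * controlAvg (fun j => 1 / (1 - (p n j : ℝ)) ^ 2) z))
          / controlAvg (fun j => 1 / (1 - (p n j : ℝ))) z ^ 2
  have hW : TendstoInProb (fun n => designLaw (p n))
      (fun n z => (treatedAvg (fun j => 1 / (p n j : ℝ)) z
        * controlAvg (fun j => 1 / (1 - (p n j : ℝ))) z * √(V n z))⁻¹) (√(u1 + u0))⁻¹ := by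
    have h := (((hs1.prodMk hc1).prodMk he1).prodMk ((hs0.prodMk hc0).prodMk he0)).prodMk
      (hd1.prodMk hd0)
    have hsq : √(u1 + u0) ≠ 0 := (Real.sqrt_pos.2 hu).ne'
    have := h.comp_continuousAt (g := fun q : (((ℝ × ℝ) × ℝ) × ((ℝ × ℝ) × ℝ)) × (ℝ × ℝ) =>
      (q.2.1 * q.2.2 * √((q.1.1.1.1 - 2 * q.1.1.1.2 + q.1.1.2) / q.2.1 ^ 2
        + (q.1.2.1.1 - 2 * q.1.2.1.2 + q.1.2.2) / q.2.2 ^ 2))⁻¹)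
      (by fun_prop (disch := simp [hsq]))
    simpa [V] using this
  -- the remainder of the numerator
  have hR : TendstoInProb (fun n => designLaw (p n))
      (fun n z => √(N n : ℝ) *
        (treatedAvg (fun j => (a n j - c n) / (p n j : ℝ)) z
            * (controlAvg (fun j => 1 / (1 - (p n j : ℝ))) z - 1)
          - controlAvg (fun j => (b n j - c n) / (1 - (p n j : ℝ))) z
            * (treatedAvg (fun j => 1 / (p n j : ℝ)) z - 1))) 0 := by
    -- Each term of the remainder is a product of two pure fluctuations: a centred arm average and
    -- the deviation of the other arm's normalization from `1`.
    have h1 := tendstoInProb_sqrt_mul_centeredSum_div_mul (p := p) hN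
      (B1.mono fun n h => h.2.1) (B0.mono fun n h => h.1)
    have h2 := tendstoInProb_sqrt_mul_centeredSum_div_mul (p := p) hN
      (B0.mono fun n h => h.2.1) (B1.mono fun n h => h.1)
    have h := h2.sub h1
    rw [sub_zero] at h
    refine h.congr_eventually ?_
    filter_upwards [eM1, eM0, hNpos] with n h1 h0 hn
    ext z
    rw [treatedAvg_eq (p n), treatedAvg_eq (p n), controlAvg_eq (p n), controlAvg_eq (p n), h1, h0]
    have f1 : (∑ j, (p n j : ℝ) * (1 / (p n j : ℝ))) / (N n : ℝ) = 1 := by simp [hp1, hn.ne']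
    have f0 : (∑ j, (1 - (p n j : ℝ)) * (1 / (1 - (p n j : ℝ)))) / (N n : ℝ) = 1 := by
      simp [hp0, hn.ne']
    rw [f1, f0]
    ring
  -- the leading term
  set k : ∀ n, Fin (N n) → ℝ := fun n j =>
    (a n j - c n) / (p n j : ℝ) + (b n j - c n) / (1 - (p n j : ℝ)) with hk
  have hk4 : ∀ᶠ n in atTop, (∑ j, k n j ^ 4) / (N n : ℝ) ≤ pm⁻¹ ^ 4 * 8 * (C + C) := by
    filter_upwards [hCa, hCb] with n h1 h0
    calc (∑ j, k n j ^ 4) / (N n : ℝ)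
        ≤ (∑ j, pm⁻¹ ^ 4 * 8 * ((a n j - c n) ^ 4 + (b n j - c n) ^ 4)) / (N n : ℝ) := by
          gcongr with j
          exact arm_weight_pow_four_le hpm (hp n j).1 (hp0' n j)
      _ = pm⁻¹ ^ 4 * 8 * ((∑ j, (a n j - c n) ^ 4) / (N n : ℝ)
            + (∑ j, (b n j - c n) ^ 4) / (N n : ℝ)) := by
          rw [← Finset.mul_sum, Finset.sum_add_distrib]; ring
      _ ≤ _ := by gcongr
  -- Neyman's decomposition, session by session: `p (1 - p) (x / p + y / (1 - p))² = x² / p + y² /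
  -- (1 - p) - (x - y)²`, where the centre cancels in `x - y`.
  have hs : Tendsto (fun n => (∑ j, (p n j : ℝ) * (1 - p n j) * k n j ^ 2) / (N n : ℝ)) atTop
      (𝓝 (u1 + u0 - w)) := by
    refine ((hu1.add hu0).sub hw).congr fun n => ?_
    rw [← add_div, ← sub_div, ← Finset.sum_add_distrib, ← Finset.sum_sub_distrib]
    congr 1
    refine Finset.sum_congr rfl fun j _ => ?_
    have h1 := hp1 n j
    have h0 := hp0 n j
    simp only [hk]
    field_simp
    ring
  have hs_nonneg : 0 ≤ u1 + u0 - w := by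
    refine ge_of_tendsto' hs fun n => div_nonneg (Finset.sum_nonneg fun j _ => ?_) (by positivity)
    exact mul_nonneg (mul_nonneg (p n j).2.1 (sub_nonneg.2 (p n j).2.2)) (sq_nonneg _)
  obtain ⟨v, hv⟩ : ∃ v : NNReal, (v : ℝ) = u1 + u0 - w := ⟨⟨_, hs_nonneg⟩, rfl⟩
  have hX := tendstoInDistribution_centeredSum hN p k hk4 (v := v) (by rwa [hv])
  rw [← hv]
  refine TendstoInDistribution.add_mul_gaussian hu hX hR hW ?_
  -- Where both normalizations are within `1/2` of `1`, neither arm is empty and the closed form of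
  -- the statistic applies.
  have h2 := (hd1 (1 / 2) (by norm_num)).add (hd0 (1 / 2) (by norm_num))
  rw [add_zero] at h2
  refine tendsto_of_tendsto_of_tendsto_of_le_of_le' tendsto_const_nhds h2
    (Eventually.of_forall fun _ => zero_le) ?_
  filter_upwards [eM1, eM0, hNpos] with n e1 e0 hn
  refine (measure_mono fun z hz => ?_).trans (measure_union_le _ _)
  by_contra hcon
  simp only [Set.mem_union, Set.mem_ofPred_eq, not_or, not_le, Real.dist_eq, abs_lt] at hcon
  refine hz ?_
  rw [tReg_eq hn (p n) (a n) (b n) (c n) z rfl rfl rfl rfl (V := V n z) rfl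
    (by linarith [hcon.1.1]) (by linarith [hcon.2.1])]
  have hNr : (0 : ℝ) < N n := by exact_mod_cast hn
  have ek : (√(N n : ℝ))⁻¹ * centeredSum (p n) (k n) z = √(N n : ℝ) *
      (treatedAvg (fun j => (a n j - c n) / (p n j : ℝ)) z
        - controlAvg (fun j => (b n j - c n) / (1 - (p n j : ℝ))) z) := by
    rw [treatedAvg_eq (p n), controlAvg_eq (p n), e1, e0, add_zero, zero_sub, sub_neg_eq_add,
      ← add_div, mul_div_assoc', mul_div_right_comm, Real.sqrt_div_self', one_div]
    congr 1
    simp only [centeredSum, ← Finset.sum_add_distrib, hk]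
    exact Finset.sum_congr rfl fun j _ => by ring
  rw [ek]
  ring

end TRegLimit

/-! ### Gaussian tail probabilities and comparison with the uniform law. -/

section GaussianTail

/-- The upper tail probability of the standard Gaussian law. -/
noncomputable def gaussianTail (x : ℝ) : ℝ := (gaussianReal 0 1).real (Set.Ici x)

theorem gaussianTail_eq_integral (x : ℝ) :
    gaussianTail x = ∫ t in Set.Ioi x, gaussianPDFReal 0 1 t := by
  rw [gaussianTail, measureReal_def, gaussianReal_apply_eq_integral _ one_ne_zero,
    ENNReal.toReal_ofReal (integral_nonneg fun t => gaussianPDFReal_nonneg 0 1 t),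
    integral_Ici_eq_integral_Ioi]

theorem continuous_gaussianPDFReal_std : Continuous (gaussianPDFReal 0 1) := by
  unfold gaussianPDFReal; fun_prop

theorem hasDerivAt_gaussianTail (x : ℝ) :
    HasDerivAt gaussianTail (-gaussianPDFReal 0 1 x) x := by
  have hi := integrable_gaussianPDFReal 0 1
  have e : gaussianTail = fun y => gaussianTail 0 - ∫ t in (0 : ℝ)..y, gaussianPDFReal 0 1 t := by
    ext y
    rw [gaussianTail_eq_integral, gaussianTail_eq_integral,
      ← intervalIntegral.integral_Ioi_sub_Ioi' hi.integrableOn hi.integrableOn]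
    ring
  rw [e]
  exact (intervalIntegral.integral_hasDerivAt_right (hi.intervalIntegrable)
    (continuous_gaussianPDFReal_std.stronglyMeasurableAtFilter _ _)
    continuous_gaussianPDFReal_std.continuousAt).const_sub _

theorem continuous_gaussianTail : Continuous gaussianTail :=
  continuous_iff_continuousAt.2 fun x => (hasDerivAt_gaussianTail x).continuousAt

theorem antitone_gaussianTail : Antitone gaussianTail := fun _ _ h =>
  measureReal_mono (Set.Ici_subset_Ici.2 h)

theorem gaussianTail_nonneg (x : ℝ) : 0 ≤ gaussianTail x := measureReal_nonneg

theorem gaussianTail_le_one (x : ℝ) : gaussianTail x ≤ 1 := measureReal_le_one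

theorem gaussianTail_neg (x : ℝ) : gaussianTail (-x) = 1 - gaussianTail x := by
  have h : (gaussianReal 0 1).map (fun x => -x) = gaussianReal 0 1 := by
    rw [gaussianReal_map_neg, neg_zero]
  have h1 : gaussianTail (-x) = (gaussianReal 0 1).real (Set.Iic x) := by
    rw [gaussianTail, ← h, map_measureReal_apply (by fun_prop) measurableSet_Ici, h]
    congr 1
    ext y
    simp
  have h2 : gaussianTail x = (gaussianReal 0 1).real (Set.Ioi x) := by
    rw [gaussianTail_eq_integral, measureReal_def, gaussianReal_apply_eq_integral _ one_ne_zero,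
      ENNReal.toReal_ofReal (integral_nonneg fun t => gaussianPDFReal_nonneg 0 1 t)]
  rw [h1, h2, ← Set.compl_Ioi, probReal_compl_eq_one_sub measurableSet_Ioi]

theorem gaussianTail_zero : gaussianTail 0 = 1 / 2 := by
  have := gaussianTail_neg 0
  rw [neg_zero] at this
  linarith

theorem tendsto_gaussianTail_atBot : Tendsto gaussianTail atBot (𝓝 1) := by
  have h := tendsto_measure_Ici_atBot (gaussianReal 0 1)
  have h2 := (ENNReal.tendsto_toReal (measure_ne_top _ _)).comp h
  rw [measure_univ, ENNReal.toReal_one] at h2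
  exact h2

theorem tendsto_gaussianTail_atTop : Tendsto gaussianTail atTop (𝓝 0) := by
  have h := (tendsto_gaussianTail_atBot.comp tendsto_neg_atTop_atBot).const_sub 1
  rw [sub_self] at h
  refine h.congr fun x => ?_
  simp [gaussianTail_neg]

theorem exists_bound_comp_gaussianTail {g : ℝ → ℝ} (hg : Continuous g) :
    ∃ K, ∀ x, ‖g (gaussianTail x)‖ ≤ K := by
  obtain ⟨K, hK⟩ := (isCompact_Icc (a := (0 : ℝ)) (b := 1)).exists_bound_of_continuousOn
    hg.continuousOn
  exact ⟨K, fun x => hK _ ⟨gaussianTail_nonneg x, gaussianTail_le_one x⟩⟩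

/-- The upper tail probability of a standard Gaussian variable is uniform on the unit interval. -/
theorem integral_comp_gaussianTail {g : ℝ → ℝ} (hg : Continuous g) :
    ∫ x, g (gaussianTail x) ∂(gaussianReal 0 1) = ∫ t in (0 : ℝ)..1, g t := by
  rw [integral_gaussianReal_eq_integral_smul one_ne_zero]
  obtain ⟨K, hK⟩ := exists_bound_comp_gaussianTail hg
  have hF : ∀ y, HasDerivAt (fun y => ∫ t in (0 : ℝ)..y, g t) (g y) y := fun y =>
    intervalIntegral.integral_hasDerivAt_right (hg.intervalIntegrable _ _)
      (hg.stronglyMeasurableAtFilter _ _) hg.continuousAt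
  have hFc : Continuous fun y => ∫ t in (0 : ℝ)..y, g t :=
    continuous_iff_continuousAt.2 fun y => (hF y).continuousAt
  -- The substitution `t = gaussianTail x`, performed with an explicit primitive on the whole line.
  have hd : ∀ x, HasDerivAt (fun x => -∫ t in (0 : ℝ)..gaussianTail x, g t)
      (gaussianPDFReal 0 1 x • g (gaussianTail x)) x := by
    intro x
    have h := ((hF _).comp x (hasDerivAt_gaussianTail x)).neg
    rw [mul_neg, neg_neg, mul_comm] at h
    exact h
  have hi : Integrable fun x => gaussianPDFReal 0 1 x • g (gaussianTail x) :=
    (integrable_gaussianPDFReal 0 1).mul_bdd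
      (hg.comp continuous_gaussianTail).aestronglyMeasurable (Eventually.of_forall hK)
  rw [integral_of_hasDerivAt_of_tendsto hd hi
    ((hFc.tendsto 1).comp tendsto_gaussianTail_atBot).neg
    ((hFc.tendsto 0).comp tendsto_gaussianTail_atTop).neg]
  simp

/-- Shrinking a Gaussian variable decreases the expectation of a function of the tail probability
whose symmetrization decreases away from the endpoints. -/
theorem integral_comp_gaussianTail_mul_le {g : ℝ → ℝ} (hg : Continuous g) {r : ℝ} (h0 : 0 ≤ r)
    (h1 : r ≤ 1)
    (h : r = 1 ∨ ∀ x y, 0 ≤ x → x ≤ y → y ≤ 1 / 2 → g y + g (1 - y) ≤ g x + g (1 - x)) :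
    ∫ x, g (gaussianTail (r * x)) ∂(gaussianReal 0 1) ≤ ∫ t in (0 : ℝ)..1, g t := by
  rw [← integral_comp_gaussianTail hg]
  rcases h with rfl | h
  · simp
  obtain ⟨K, hK⟩ := exists_bound_comp_gaussianTail hg
  have hi : ∀ c : ℝ, Integrable (fun x => g (gaussianTail (c * x))) (gaussianReal 0 1) := fun c =>
    Integrable.of_bound (by
      have := hg.comp (continuous_gaussianTail.comp (continuous_const_mul c))
      exact this.aestronglyMeasurable) K (Eventually.of_forall fun x => hK _)
  -- By symmetry of the Gaussian law, twice each integral is the integral of the symmetrized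
  -- integrand, so a pointwise comparison of symmetrizations suffices.
  have hneg : ∀ c : ℝ, ∫ x, g (gaussianTail (-c * x)) ∂(gaussianReal 0 1)
      = ∫ x, g (gaussianTail (c * x)) ∂(gaussianReal 0 1) := by
    intro c
    have e : (gaussianReal 0 1).map (fun x => -x) = gaussianReal 0 1 := by
      rw [gaussianReal_map_neg, neg_zero]
    conv_rhs => rw [← e]
    rw [integral_map (by fun_prop) (by
      have := hg.comp (continuous_gaussianTail.comp (continuous_const_mul c))
      exact this.aestronglyMeasurable)]
    simp
  -- For `x ≥ 0`, shrinking moves the tail probability towards `1/2`: `gaussianTail x ≤ gaussianTail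
  -- (r * x) ≤ 1/2`.
  have hnn : ∀ x : ℝ, 0 ≤ x → g (gaussianTail (r * x)) + g (1 - gaussianTail (r * x))
      ≤ g (gaussianTail x) + g (1 - gaussianTail x) := fun x hx =>
    h _ _ (gaussianTail_nonneg _) (antitone_gaussianTail (mul_le_of_le_one_left hx h1))
      (by rw [← gaussianTail_zero]; exact antitone_gaussianTail (mul_nonneg h0 hx))
  have hle : ∀ x : ℝ, g (gaussianTail (r * x)) + g (gaussianTail (-r * x))
      ≤ g (gaussianTail (1 * x)) + g (gaussianTail (-1 * x)) := by
    intro x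
    rw [neg_mul, neg_mul, gaussianTail_neg, gaussianTail_neg, one_mul]
    rcases le_total 0 x with hx | hx
    · exact hnn x hx
    · have := hnn (-x) (by linarith)
      rw [mul_neg, gaussianTail_neg, gaussianTail_neg, sub_sub_cancel, sub_sub_cancel] at this
      linarith
  have := integral_mono ((hi r).add (hi (-r))) ((hi 1).add (hi (-1))) hle
  simp only [Pi.add_apply] at this
  rw [integral_add (hi r) (hi (-r)), integral_add (hi 1) (hi (-1)), hneg, hneg] at this
  simp only [one_mul] at this
  linarith

end GaussianTail

/-! ### Binomial lower tails through Bernstein polynomials. -/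

section BinomialTail

/-- The probability that a binomial variable with parameters `M` and `q` is less than `k`. -/
noncomputable def binomialLower (M k : ℕ) (q : ℝ) : ℝ :=
  ∑ i ∈ Finset.range k, (bernsteinPolynomial ℝ M i).eval q

theorem continuous_binomialLower (M k : ℕ) : Continuous (binomialLower M k) := by
  unfold binomialLower
  exact continuous_finsetSum _ fun i _ => (bernsteinPolynomial ℝ M i).continuous

theorem bernsteinPolynomial_eval (M i : ℕ) (q : ℝ) :
    (bernsteinPolynomial ℝ M i).eval q = M.choose i * q ^ i * (1 - q) ^ (M - i) := by
  simp [bernsteinPolynomial]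

/-- Up to the factor `M + 1`, the difference of consecutive polynomials is the derivative of one of
degree `M + 1` that vanishes at both endpoints, except at the last index. So all the integrals
agree, and the last one gives their value. -/
theorem integral_bernsteinPolynomial_eval (M : ℕ) {i : ℕ} (hi : i ≤ M) :
    ∫ q in (0 : ℝ)..1, (bernsteinPolynomial ℝ M i).eval q = 1 / (M + 1) := by
  have key : ∀ i : ℕ, (∫ q in (0 : ℝ)..1, (bernsteinPolynomial ℝ M i).eval q)
      - ∫ q in (0 : ℝ)..1, (bernsteinPolynomial ℝ M (i + 1)).eval q
      = (if i = M then 1 else 0) / (M + 1) := by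
    intro i
    have h := intervalIntegral.integral_eq_sub_of_hasDerivAt (a := (0 : ℝ)) (b := 1)
      (fun x _ => (bernsteinPolynomial ℝ (M + 1) (i + 1)).hasDerivAt x)
      ((Polynomial.continuous _).intervalIntegrable _ _)
    rw [bernsteinPolynomial.derivative_succ_aux, bernsteinPolynomial.eval_at_0,
      bernsteinPolynomial.eval_at_1] at h
    simp only [Polynomial.eval_mul, Polynomial.eval_sub, Polynomial.eval_add,
      Polynomial.eval_natCast, Polynomial.eval_one] at h
    rw [intervalIntegral.integral_const_mul, intervalIntegral.integral_sub
      ((Polynomial.continuous _).intervalIntegrable _ _)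
      ((Polynomial.continuous _).intervalIntegrable _ _)] at h
    rw [eq_div_iff (by positivity), mul_comm, h]
    simp
  induction hd : M - i generalizing i with
  | zero =>
    obtain rfl : i = M := by omega
    have h := key i
    rw [bernsteinPolynomial.eq_zero_of_lt ℝ (Nat.lt_succ_self i)] at h
    simpa using h
  | succ d ih =>
    have h := key i
    rw [ih (i := i + 1) (by omega) (by omega), if_neg (by omega), zero_div] at h
    linarith

/-- With a uniform success probability all `M + 1` counts are equally likely; this gives the level
of the test when `q` is uniform. -/
theorem integral_binomialLower {M k : ℕ} (hk : k ≤ M + 1) :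
    ∫ q in (0 : ℝ)..1, binomialLower M k q = k / (M + 1) := by
  unfold binomialLower
  rw [intervalIntegral.integral_finsetSum fun i _ =>
    (Polynomial.continuous _).intervalIntegrable _ _, Finset.sum_congr rfl fun i hi =>
    integral_bernsteinPolynomial_eval M (i := i) (by have := Finset.mem_range.1 hi; omega)]
  simp [div_eq_mul_inv]

/-- The derivatives of the Bernstein polynomials telescope. -/
theorem hasDerivAt_binomialLower (M k : ℕ) (q : ℝ) : HasDerivAt (binomialLower (M + 1) (k + 1))
    (-(M + 1) * (bernsteinPolynomial ℝ M k).eval q) q := by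
  induction k with
  | zero =>
    have h := (bernsteinPolynomial ℝ (M + 1) 0).hasDerivAt q
    rw [bernsteinPolynomial.derivative_zero] at h
    have e : binomialLower (M + 1) (0 + 1) = fun q => (bernsteinPolynomial ℝ (M + 1) 0).eval q := by
      ext q; simp [binomialLower]
    rw [e]
    simpa using h
  | succ k ih =>
    have h := (bernsteinPolynomial ℝ (M + 1) (k + 1)).hasDerivAt q
    have e : binomialLower (M + 1) (k + 1 + 1) = fun q => binomialLower (M + 1) (k + 1) q
        + (bernsteinPolynomial ℝ (M + 1) (k + 1)).eval q := by
      ext q; simp [binomialLower, Finset.sum_range_succ]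
    rw [bernsteinPolynomial.derivative_succ_aux] at h
    rw [e]
    refine (ih.add h).congr_deriv ?_
    simp
    ring

/-- After lowering `M` and `k` by one, the derivative of the symmetrization is `-(M + 1)` times
`M.choose k * q ^ k * (1 - q) ^ k * ((1 - q) ^ d - q ^ d)` with `d = M - 2 k`. It is nonpositive for
`q ≤ 1/2` because `d ≥ 0`; this is where levels below `1/2` enter. -/
theorem binomialLower_symm_antitone {M k : ℕ} (hk : 2 * k ≤ M + 1) {x y : ℝ} (hx : 0 ≤ x)
    (hxy : x ≤ y) (hy : y ≤ 1 / 2) :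
    binomialLower M k y + binomialLower M k (1 - y)
      ≤ binomialLower M k x + binomialLower M k (1 - x) := by
  rcases k with _ | k
  · simp [binomialLower]
  obtain ⟨M, rfl⟩ : ∃ M', M = M' + 1 := ⟨M - 1, by omega⟩
  have hder : ∀ q : ℝ, HasDerivAt (fun q => binomialLower (M + 1) (k + 1) q
      + binomialLower (M + 1) (k + 1) (1 - q)) (-(M + 1) * (bernsteinPolynomial ℝ M k).eval q
      + -(-(M + 1) * (bernsteinPolynomial ℝ M k).eval (1 - q))) q := by
    intro q
    have h1 := hasDerivAt_binomialLower M k q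
    have h2 := (hasDerivAt_binomialLower M k (1 - q)).comp q ((hasDerivAt_id q).const_sub 1)
    rw [mul_neg_one] at h2
    exact h1.add h2
  have hanti : AntitoneOn (fun q => binomialLower (M + 1) (k + 1) q
      + binomialLower (M + 1) (k + 1) (1 - q)) (Set.Icc 0 (1 / 2)) := by
    refine antitoneOn_of_deriv_nonpos (convex_Icc _ _)
      (fun q _ => (hder q).continuousAt.continuousWithinAt)
      (fun q _ => (hder q).differentiableAt.differentiableWithinAt) fun q hq => ?_
    rw [interior_Icc] at hq
    rw [(hder q).deriv, bernsteinPolynomial_eval, bernsteinPolynomial_eval, sub_sub_cancel]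
    obtain ⟨d, hd⟩ : ∃ d, M - k = k + d := ⟨M - k - k, by omega⟩
    rw [hd]
    have h1 : q ^ d ≤ (1 - q) ^ d := pow_le_pow_left₀ hq.1.le (by linarith [hq.2]) d
    have h2 : 0 ≤ ((M : ℝ) + 1) * (M.choose k * (q ^ k * (1 - q) ^ k)) := by
      have : 0 ≤ 1 - q := by linarith [hq.2]
      have := hq.1.le
      positivity
    have h3 := mul_nonneg h2 (sub_nonneg.2 h1)
    rw [pow_add, pow_add]
    nlinarith
  exact hanti ⟨hx, hxy.trans hy⟩ ⟨hx.trans hxy, hy⟩ hxy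

theorem bernsteinPolynomial_eval_nonneg (M i : ℕ) {q : ℝ} (h0 : 0 ≤ q) (h1 : q ≤ 1) :
    0 ≤ (bernsteinPolynomial ℝ M i).eval q := by
  have : 0 ≤ 1 - q := by linarith
  rw [bernsteinPolynomial_eval]; positivity

theorem binomialLower_le_one {M k : ℕ} (hk : k ≤ M + 1) {q : ℝ} (h0 : 0 ≤ q) (h1 : q ≤ 1) :
    binomialLower M k q ≤ 1 := by
  have h := congrArg (Polynomial.eval q) (bernsteinPolynomial.sum ℝ M)
  rw [Polynomial.eval_finsetSum, Polynomial.eval_one] at h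
  rw [← h]
  exact Finset.sum_le_sum_of_subset_of_nonneg (Finset.range_subset_range.2 hk)
    fun i _ _ => bernsteinPolynomial_eval_nonneg M i h0 h1

/-- Chebyshev's inequality for the lower tail of the binomial distribution. -/
theorem binomialLower_le {M k : ℕ} (hM : 0 < M) (hk : k ≤ M + 1) {a ε q : ℝ} (hε : 0 < ε)
    (ha : ∀ i < k, (i : ℝ) ≤ a * M) (h1 : q ≤ 1) (h0 : 0 ≤ q) (hq : a + ε ≤ q) :
    binomialLower M k q ≤ 1 / (M * ε ^ 2) := by
  have hMr : (0 : ℝ) < M := by exact_mod_cast hM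
  have h := congrArg (Polynomial.eval q) (bernsteinPolynomial.variance ℝ M)
  rw [Polynomial.eval_finsetSum] at h
  simp only [Polynomial.eval_mul, Polynomial.eval_pow, Polynomial.eval_sub,
    Polynomial.eval_X, Polynomial.eval_natCast, Polynomial.eval_one, nsmul_eq_mul] at h
  have h2 : (M * ε) ^ 2 * binomialLower M k q ≤ M * q * (1 - q) := by
    rw [← h, binomialLower, Finset.mul_sum]
    refine (Finset.sum_le_sum fun i hi => ?_).trans (Finset.sum_le_sum_of_subset_of_nonneg
      (Finset.range_subset_range.2 hk) fun i _ _ =>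
        mul_nonneg (sq_nonneg _) (bernsteinPolynomial_eval_nonneg M i h0 h1))
    refine mul_le_mul_of_nonneg_right ?_ (bernsteinPolynomial_eval_nonneg M i h0 h1)
    have := ha i (Finset.mem_range.1 hi)
    refine pow_le_pow_left₀ (by positivity) ?_ 2
    nlinarith
  have h3 : (M : ℝ) * q * (1 - q) ≤ M := by
    nlinarith [mul_nonneg h0 (sub_nonneg.2 h1),
      mul_le_mul_of_nonneg_left (show q * (1 - q) ≤ 1 by nlinarith) hMr.le]
  rw [le_div_iff₀ (by positivity)]
  have h4 : (M : ℝ) * (binomialLower M k q * (M * ε ^ 2)) ≤ M * 1 := by linarith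
  exact le_of_mul_le_mul_left h4 hMr

end BinomialTail

/-! ### Uniform Gaussian approximation of the randomization distribution. -/

section UniformTail

theorem gaussianPDFReal_std_le_one (x : ℝ) : gaussianPDFReal 0 1 x ≤ 1 := by
  rw [gaussianPDFReal]
  have h1 : (1 : ℝ) ≤ √(2 * Real.pi * (1 : NNReal)) := by
    rw [Real.one_le_sqrt]
    have := Real.pi_gt_three
    simp
    linarith
  refine mul_le_one₀ (inv_le_one_of_one_le₀ h1) (Real.exp_pos _).le (Real.exp_le_one_iff.2 ?_)
  rw [neg_div, neg_nonpos]
  positivity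

theorem gaussianTail_sub_le {x δ : ℝ} (hδ : 0 ≤ δ) : gaussianTail (x - δ) ≤ gaussianTail x + δ := by
  have h : LipschitzWith 1 gaussianTail := by
    refine lipschitzWith_of_nnnorm_deriv_le (fun x => (hasDerivAt_gaussianTail x).differentiableAt)
      fun x => ?_
    rw [(hasDerivAt_gaussianTail x).deriv, nnnorm_neg]
    rw [← NNReal.coe_le_coe, coe_nnnorm, Real.norm_of_nonneg (gaussianPDFReal_nonneg _ _ _)]
    exact gaussianPDFReal_std_le_one x
  have := h.dist_le_mul (x - δ) x
  rw [Real.dist_eq, Real.dist_eq] at this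
  simp [abs_of_nonneg hδ] at this
  linarith [(abs_le.1 this).2]

/-- Pólya's theorem: convergence in distribution to the standard Gaussian law is uniform for the
tail probabilities. -/
theorem eventually_forall_abs_tail_sub_le {Ω : ℕ → Type*} [∀ n, MeasurableSpace (Ω n)]
    {μ : ∀ n, Measure (Ω n)} [∀ n, IsProbabilityMeasure (μ n)] {X : ∀ n, Ω n → ℝ} {Ω' : Type*}
    [MeasurableSpace Ω'] {μ' : Measure Ω'} [IsProbabilityMeasure μ'] {Z : Ω' → ℝ}
    (h : TendstoInDistribution X atTop Z μ μ') (hZ : μ'.map Z = gaussianReal 0 1)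
    {ε : ℝ} (hε : 0 < ε) :
    ∀ᶠ n in atTop, ∀ x : ℝ, |(μ n).real {ω | x ≤ X n ω} - gaussianTail x| ≤ ε := by
  -- Lévy–Prokhorov distance below `ε / 2` shifts half-lines by at most `ε / 2`, and the Gaussian
  -- tail is `1`-Lipschitz, so the total error is `ε`.
  have h1 := ((LevyProkhorov.continuous_ofMeasure_probabilityMeasure (Ω := ℝ)).tendsto _).comp
    h.tendsto
  have h2 := (EMetric.tendsto_nhds.1 h1) (ENNReal.ofReal (ε / 2)) (by simpa using hε)
  filter_upwards [h2] with n hn x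
  have hn' : levyProkhorovEDist ((μ n).map (X n)) (gaussianReal 0 1) < ENNReal.ofReal (ε / 2) := by
    rw [← hZ]; exact hn
  have hthick : ∀ y, Metric.thickening (ENNReal.ofReal (ε / 2)).toReal (Set.Ici y)
      ⊆ Set.Ici (y - ε / 2) := by
    intro y w hw
    rw [ENNReal.toReal_ofReal (by positivity)] at hw
    obtain ⟨v, hv, hd⟩ := Metric.mem_thickening_iff.1 hw
    rw [Real.dist_eq, abs_lt] at hd
    have := Set.mem_Ici.1 hv
    exact Set.mem_Ici.2 (by linarith [hd.1])
  have e : ∀ y, (μ n).real {ω | y ≤ X n ω} = ((μ n).map (X n)).real (Set.Ici y) := by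
    intro y
    rw [map_measureReal_apply_of_aemeasurable (h.forall_aemeasurable n) measurableSet_Ici]
    rfl
  have : IsProbabilityMeasure ((μ n).map (X n)) :=
    Measure.isProbabilityMeasure_map (h.forall_aemeasurable n)
  have hl : ∀ y, ((μ n).map (X n)).real (Set.Ici y) ≤ gaussianTail (y - ε / 2) + ε / 2 := by
    intro y
    have := (left_measure_le_of_levyProkhorovEDist_lt hn' (measurableSet_Ici (a := y))).trans
      (add_le_add_left (measure_mono (hthick y)) _)
    have := ENNReal.toReal_mono (by finiteness) this
    rwa [ENNReal.toReal_add (by finiteness) (by finiteness),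
      ENNReal.toReal_ofReal (by positivity)] at this
  have hr : ∀ y, gaussianTail y ≤ ((μ n).map (X n)).real (Set.Ici (y - ε / 2)) + ε / 2 := by
    intro y
    have := (right_measure_le_of_levyProkhorovEDist_lt hn' (measurableSet_Ici (a := y))).trans
      (add_le_add_left (measure_mono (hthick y)) _)
    have := ENNReal.toReal_mono (by finiteness) this
    rwa [ENNReal.toReal_add (by finiteness) (by finiteness),
      ENNReal.toReal_ofReal (by positivity)] at this
  rw [e, abs_le]
  have a1 := hl x
  have a2 := hr (x + ε / 2)
  have a3 := gaussianTail_sub_le (x := x) (δ := ε / 2) (by positivity)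
  have a4 := gaussianTail_sub_le (x := x + ε / 2) (δ := ε / 2) (by positivity)
  rw [add_sub_cancel_right] at a2 a4
  constructor <;> linarith

/-- The randomization distribution of the studentized statistic is close to the standard Gaussian
law uniformly over the outcomes with controlled moments. -/
theorem exists_forall_abs_tail_tReg_sub_le {p : ∀ J, Fin J → I} {pm : ℝ} (hpm : 0 < pm)
    (hp : ∀ J j, pm ≤ (p J j : ℝ) ∧ (p J j : ℝ) ≤ 1 - pm) (C : ℝ) {u1 u0 : ℝ} (hu : 0 < u1 + u0)
    {ε : ℝ} (hε : 0 < ε) :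
    ∃ δ : ℝ, 0 < δ ∧ ∃ J0 : ℕ, ∀ J, J0 ≤ J → ∀ y : Fin J → ℝ,
      (∑ j, (y j - (∑ i, y i) / J) ^ 4) / (J : ℝ) ≤ C →
      |(∑ j, (y j - (∑ i, y i) / J) ^ 2 / (p J j : ℝ)) / (J : ℝ) - u1| ≤ δ →
      |(∑ j, (y j - (∑ i, y i) / J) ^ 2 / (1 - (p J j : ℝ))) / (J : ℝ) - u0| ≤ δ →
      ∀ x : ℝ, |(designLaw (p J)).real {z | x ≤ tReg (p J) y z} - gaussianTail x| ≤ ε := by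
  -- Failure of uniformity produces outcome vectors along some sequence `N n ≥ n` that satisfy the
  -- moment conditions ever more sharply; the limit theorem along this sequence contradicts them.
  by_contra! hcon
  have hcon' := fun n : ℕ => hcon (1 / ((n : ℝ) + 1)) (by positivity) n
  choose N hN y hC h1 h0 x hx using hcon'
  have hNt : Tendsto N atTop atTop := tendsto_atTop_mono hN tendsto_id
  have hsum : ∀ᶠ n in atTop, ∑ j, (y n j - (∑ i, y n i) / (N n : ℝ)) = 0 := by
    filter_upwards [hNt.eventually_gt_atTop 0] with n hn
    have : (N n : ℝ) ≠ 0 := by exact_mod_cast hn.ne'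
    rw [Finset.sum_sub_distrib]
    simp
    field_simp
    simp
  have hlim : ∀ {f : ℕ → ℝ} {l : ℝ}, (∀ n : ℕ, |f n - l| ≤ 1 / ((n : ℝ) + 1)) →
      Tendsto f atTop (𝓝 l) := by
    intro f l hf
    rw [tendsto_iff_norm_sub_tendsto_zero]
    exact squeeze_zero (fun n => norm_nonneg _) hf tendsto_one_div_add_atTop_nhds_zero_nat
  -- With outcomes held fixed both arms carry the same values, so `w = 0` and the limit variance is
  -- one.
  have hT := tendstoInDistribution_tReg hNt hpm (fun n j => hp (N n) j) (a := y) (b := y) hsum hsum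
    (Eventually.of_forall hC) (Eventually.of_forall hC) (hlim h1) (hlim h0) (w := 0)
    (by simp) hu
  rw [sub_zero, div_self hu.ne', Real.sqrt_one] at hT
  have hev := eventually_forall_abs_tail_sub_le hT (by simp) hε
  obtain ⟨n, hn⟩ := hev.exists
  have e : ∀ z, observe (y n) (y n) z = y n := fun z => by ext j; simp [observe]
  have := hn (x n)
  simp only [e] at this
  exact absurd this (not_le.2 (hx n))

end UniformTail

/-! ### From weak convergence to convergence of moments. -/

section WeakMoments

/-- Weakly convergent averages with bounded second moments of `f` converge after integration of
`f`. -/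
theorem integrable_and_tendsto_avg {E : Type*} [TopologicalSpace E] [MeasurableSpace E]
    [OpensMeasurableSpace E] {x : ∀ J : ℕ, Fin J → E} {ν : Measure E} [IsProbabilityMeasure ν]
    (hweak : ∀ f : BoundedContinuousFunction E ℝ,
      Tendsto (fun J : ℕ => (∑ j, f (x J j)) / (J : ℝ)) atTop (𝓝 (∫ y, f y ∂ν)))
    {f : E → ℝ} (hf : Continuous f) {K : ℝ}
    (hK : ∀ᶠ J : ℕ in atTop, (∑ j, f (x J j) ^ 2) / (J : ℝ) ≤ K) :
    Integrable f ν ∧ Tendsto (fun J : ℕ => (∑ j, f (x J j)) / (J : ℝ)) atTop (𝓝 (∫ y, f y ∂ν)) := by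
  have hK0 : 0 ≤ K := by
    obtain ⟨J, hJ⟩ := hK.exists
    exact le_trans (by positivity) hJ
  -- the second moment of the limit
  have hmin : ∀ n : ℕ, ∫ y, min (f y ^ 2) n ∂ν ≤ K := by
    intro n
    let g : BoundedContinuousFunction E ℝ := BoundedContinuousFunction.ofNormedAddCommGroup
      (fun y => min (f y ^ 2) n) (by fun_prop) n (fun y => by
        rw [Real.norm_of_nonneg (le_min (sq_nonneg _) (Nat.cast_nonneg _))]; exact min_le_right _ _)
    refine le_of_tendsto (hweak g) ?_
    filter_upwards [hK] with J hJ
    refine le_trans ?_ hJ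
    gcongr with j
    exact min_le_left _ _
  have hlin : ∫⁻ y, ENNReal.ofReal (f y ^ 2) ∂ν ≤ ENNReal.ofReal K := by
    have h1 : ∀ y, ENNReal.ofReal (f y ^ 2) = liminf (fun n : ℕ => ENNReal.ofReal (min (f y ^ 2) n))
        atTop := by
      intro y
      refine (Tendsto.liminf_eq ?_).symm
      refine tendsto_const_nhds.congr' ?_
      filter_upwards [eventually_ge_atTop ⌈f y ^ 2⌉₊] with n hn
      rw [min_eq_left (Nat.ceil_le.1 hn)]
    simp_rw [h1]
    refine (lintegral_liminf_le fun n => by fun_prop).trans ?_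
    refine liminf_le_of_le (by isBoundedDefault) fun b hb => ?_
    obtain ⟨n, hn⟩ := hb.exists
    refine hn.trans ?_
    rw [← ofReal_integral_eq_lintegral_ofReal]
    · exact ENNReal.ofReal_le_ofReal (hmin n)
    · refine Integrable.of_bound (by fun_prop) n (Eventually.of_forall fun y => ?_)
      rw [Real.norm_of_nonneg (le_min (sq_nonneg _) (Nat.cast_nonneg _))]; exact min_le_right _ _
    · exact Eventually.of_forall fun y => le_min (sq_nonneg _) (Nat.cast_nonneg _)
  have hsq : Integrable (fun y => f y ^ 2) ν := by
    refine ⟨by fun_prop, ?_⟩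
    rw [hasFiniteIntegral_iff_ofReal (Eventually.of_forall fun y => sq_nonneg _)]
    exact hlin.trans_lt ENNReal.ofReal_lt_top
  have hint : ∫ y, f y ^ 2 ∂ν ≤ K := by
    rw [integral_eq_lintegral_of_nonneg_ae (Eventually.of_forall fun y => sq_nonneg _)
      hsq.aestronglyMeasurable]
    exact ENNReal.toReal_le_of_le_ofReal hK0 hlin
  have hfi : Integrable f ν :=
    ((memLp_two_iff_integrable_sq hf.aestronglyMeasurable).2 hsq).integrable one_le_two
  refine ⟨hfi, ?_⟩
  have hcut : ∀ (R : ℝ), 0 < R → ∀ t : ℝ, |t - max (-R) (min R t)| ≤ t ^ 2 / R := by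
    intro R hR t
    rw [le_div_iff₀ hR]
    rcases le_total t R with h | h
    · rw [min_eq_right h]
      rcases le_total (-R) t with h' | h'
      · rw [max_eq_right h', sub_self, abs_zero, zero_mul]; positivity
      · rw [max_eq_left h', abs_of_nonpos (by linarith)]; nlinarith
    · rw [min_eq_left h, max_eq_right (by linarith), abs_of_nonneg (by linarith)]; nlinarith
  rw [Metric.tendsto_nhds]
  intro ε hε
  -- Truncating `f` at `R` costs at most `K / R ≤ ε / 4`, both in the averages and in the limit; `K
  -- + 1` keeps `R` positive.
  set R := 4 * (K + 1) / ε with hR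
  have hR0 : 0 < R := by positivity
  have hKR : K / R ≤ ε / 4 := by
    rw [hR, div_div_eq_mul_div, div_le_div_iff₀ (by positivity) (by positivity)]
    nlinarith
  let g : BoundedContinuousFunction E ℝ := BoundedContinuousFunction.ofNormedAddCommGroup
    (fun y => max (-R) (min R (f y))) (by fun_prop) R (fun y => by
      rw [Real.norm_eq_abs, abs_le]
      exact ⟨le_max_left _ _, max_le (by linarith) (min_le_left _ _)⟩)
  have hg : ∀ y, |f y - g y| ≤ f y ^ 2 / R := fun y => hcut R hR0 (f y)
  filter_upwards [hK, (Metric.tendsto_nhds.1 (hweak g)) (ε / 4) (by positivity)] with J hJ hJ'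
  have b1 : |(∑ j, f (x J j)) / (J : ℝ) - (∑ j, g (x J j)) / (J : ℝ)| ≤ ε / 4 := by
    rw [← sub_div, ← Finset.sum_sub_distrib, abs_div, Nat.abs_cast]
    calc _ ≤ (∑ j, f (x J j) ^ 2 / R) / (J : ℝ) := by
          gcongr
          exact (Finset.abs_sum_le_sum_abs _ _).trans (Finset.sum_le_sum fun j _ => hg _)
      _ = (∑ j, f (x J j) ^ 2) / (J : ℝ) / R := by rw [← Finset.sum_div]; ring
      _ ≤ K / R := by gcongr
      _ ≤ _ := hKR
  have b2 : |∫ y, f y ∂ν - ∫ y, g y ∂ν| ≤ ε / 4 := by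
    rw [← integral_sub hfi (g.integrable ν)]
    calc _ ≤ ∫ y, |f y - g y| ∂ν := abs_integral_le_integral_abs
      _ ≤ ∫ y, f y ^ 2 / R ∂ν :=
          integral_mono (hfi.sub (g.integrable ν)).abs (hsq.div_const R) hg
      _ = (∫ y, f y ^ 2 ∂ν) / R := integral_div _ _
      _ ≤ K / R := by gcongr
      _ ≤ _ := hKR
  rw [Real.dist_eq, abs_lt] at hJ'
  rw [abs_le] at b1 b2
  rw [Real.dist_eq, abs_lt]
  constructor <;> linarith [hJ'.1, hJ'.2, b1.1, b1.2, b2.1, b2.2]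

theorem integral_empiricalMeasure {J L : ℕ} (m : ℕ) (p : Fin J → I) (Y : PotentialOutcomes (J * L))
    (f : ℝ × ℝ × ℝ → ℝ) :
    ∫ x, f x ∂(empiricalMeasure m p Y)
      = (∑ j, f ((p j : ℝ), sessionPO m Y true j, sessionPO m Y false j)) / (J : ℝ) := by
  rw [empiricalMeasure, integral_smul_measure, integral_finsetSum_measure fun j _ =>
    integrable_dirac (by simp)]
  simp [div_eq_inv_mul]

/-- The truncation of a probability to the interval of the overlap condition. -/
noncomputable def clampProb (pm q : ℝ) : ℝ := max pm (min q (1 - pm))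

/-- Truncation makes `1 / q` and `1 / (1 - q)` bounded and continuous on the whole line, as weak
convergence requires, and changes nothing under overlap. -/
theorem clampProb_of_mem {pm q : ℝ} (h : pm ≤ q ∧ q ≤ 1 - pm) : clampProb pm q = q := by
  rw [clampProb, min_eq_left h.2, max_eq_right h.1]

theorem le_clampProb (pm q : ℝ) : pm ≤ clampProb pm q := le_max_left _ _

theorem clampProb_le {pm : ℝ} (h : pm ≤ 1 / 2) (q : ℝ) : clampProb pm q ≤ 1 - pm :=
  max_le (by linarith) (min_le_right _ _)

@[fun_prop]
theorem continuous_clampProb (pm : ℝ) : Continuous (clampProb pm) := by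
  unfold clampProb; fun_prop

end WeakMoments

/-! ### Sample moments of the session triples. -/

section SampleMoments

/-- The triple of the assignment probability and the two arm values of a session. -/
noncomputable def sessionTriple {J : ℕ} (p : Fin J → I) (a b : Fin J → ℝ) (j : Fin J) :
    ℝ × ℝ × ℝ := ((p j : ℝ), a j, b j)

/-- The assumptions on a triangular array of session triples under which the asymptotic analysis
is carried out. -/
structure RegularArray (pm C : ℝ) (p : ∀ J, Fin J → I) (a b : ∀ J, Fin J → ℝ)
    (ν : Measure (ℝ × ℝ × ℝ)) : Prop where
  pm_pos : 0 < pm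
  pm_lt : pm < 1 / 2
  overlap : ∀ (J : ℕ) (j : Fin J), pm ≤ (p J j : ℝ) ∧ (p J j : ℝ) ≤ 1 - pm
  fourth_moment : ∀ J : ℕ, 1 ≤ J → (∑ j, (max |a J j| |b J j|) ^ 4) / (J : ℝ) ≤ C
  prob : IsProbabilityMeasure ν
  support : ∀ᵐ x ∂ν, pm ≤ x.1 ∧ x.1 ≤ 1 - pm
  weak : ∀ f : BoundedContinuousFunction (ℝ × ℝ × ℝ) ℝ,
    Tendsto (fun J : ℕ => (∑ j, f (sessionTriple (p J) (a J) (b J) j)) / (J : ℝ)) atTop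
      (𝓝 (∫ x, f x ∂ν))
  balanced : ∀ J : ℕ, ∑ j, a J j = ∑ j, b J j

namespace RegularArray

variable {pm C : ℝ} {p : ∀ J, Fin J → I} {a b : ∀ J, Fin J → ℝ} {ν : Measure (ℝ × ℝ × ℝ)}

theorem sq_avg_le (h : RegularArray pm C p a b ν) {f : ℝ × ℝ × ℝ → ℝ} {A : ℝ}
    (hA : ∀ x : ℝ × ℝ × ℝ, |f x| ≤ A * (1 + (max |x.2.1| |x.2.2|) ^ 2)) {J : ℕ} (hJ : 1 ≤ J) :
    (∑ j, f (sessionTriple (p J) (a J) (b J) j) ^ 2) / (J : ℝ) ≤ 2 * A ^ 2 + 2 * A ^ 2 * C := by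
  refine sum_div_le_of_forall_le (by positivity) (by positivity) (fun j => ?_)
    (h.fourth_moment J hJ)
  have h1 := hA (sessionTriple (p J) (a J) (b J) j)
  simp only [sessionTriple] at h1 ⊢
  have h2 := pow_le_pow_left₀ (abs_nonneg _) h1 2
  rw [sq_abs, mul_pow] at h2
  nlinarith [mul_nonneg (sq_nonneg A) (sq_nonneg ((max |a J j| |b J j|) ^ 2 - 1))]

/-- Quadratic growth is admissible because the fourth moment bound gives bounded second moments of
`f`. -/
theorem moments (h : RegularArray pm C p a b ν) {f : ℝ × ℝ × ℝ → ℝ} (hf : Continuous f) {A : ℝ}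
    (hA : ∀ x : ℝ × ℝ × ℝ, |f x| ≤ A * (1 + (max |x.2.1| |x.2.2|) ^ 2)) :
    Integrable f ν ∧
      Tendsto (fun J : ℕ => (∑ j, f (sessionTriple (p J) (a J) (b J) j)) / (J : ℝ)) atTop
        (𝓝 (∫ x, f x ∂ν)) := by
  have := h.prob
  refine integrable_and_tendsto_avg h.weak hf (K := 2 * A ^ 2 + 2 * A ^ 2 * C) ?_
  filter_upwards [eventually_ge_atTop 1] with J hJ using h.sq_avg_le hA hJ

end RegularArray

end SampleMoments

/-! ### Centring at sample means. -/

section Centring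

/-- Here `16 = 8 * 2`, from `(s - t)⁴ ≤ 8 (s⁴ + t⁴)` and Jensen's inequality for the mean. The
dominating `w` makes the bound hold for observed values whatever the labels. -/
theorem sum_centred_pow_four_div_le {J : ℕ} (hJ : 1 ≤ J) {v w : Fin J → ℝ} {C : ℝ}
    (hv : ∀ j, |v j| ≤ w j) (hw : (∑ j, w j ^ 4) / (J : ℝ) ≤ C) :
    (∑ j, (v j - (∑ i, v i) / J) ^ 4) / (J : ℝ) ≤ 16 * C := by
  have hJr : (0 : ℝ) < J := by exact_mod_cast hJ
  have hvC : (∑ j, v j ^ 4) / (J : ℝ) ≤ C := by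
    refine le_trans ?_ hw
    refine div_le_div_of_nonneg_right (Finset.sum_le_sum fun j _ => ?_) hJr.le
    rw [← Even.pow_abs (by decide : Even 4) (v j)]
    exact pow_le_pow_left₀ (abs_nonneg _) (hv j) 4
  have hc : ((∑ i, v i) / J) ^ 4 ≤ C := by
    refine le_trans ?_ hvC
    have := Real.pow_arith_mean_le_arith_mean_pow_of_even Finset.univ (fun _ : Fin J => (J : ℝ)⁻¹)
      v (fun _ _ => by positivity) (by simp [hJr.ne']) (n := 4) (by decide)
    rw [← Finset.mul_sum, ← Finset.mul_sum] at this
    rwa [div_eq_inv_mul, div_eq_inv_mul]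
  set c := (∑ i, v i) / (J : ℝ)
  have h4 : ∀ s t : ℝ, (s - t) ^ 4 ≤ 8 * (s ^ 4 + t ^ 4) := by
    intro s t
    have h := pow_le_pow_left₀ (sq_nonneg _) (add_sq_le (a := s) (b := -t)) 2
    nlinarith [sq_nonneg (s ^ 2 - t ^ 2)]
  calc _ ≤ (∑ j, 8 * (v j ^ 4 + c ^ 4)) / (J : ℝ) := by gcongr with j; exact h4 _ _
    _ = 8 * ((∑ j, v j ^ 4) / (J : ℝ) + c ^ 4) := by
        rw [← Finset.mul_sum, Finset.sum_add_distrib]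
        simp
        field_simp
    _ ≤ 8 * (C + C) := by gcongr
    _ = _ := by ring

/-- Recentres from a sample mean `c` to its limit `μ`, so that the corrections vanish as `c` tends
to `μ`. -/
theorem sum_centred_sq_mul_div {J : ℕ} (v g : Fin J → ℝ) (c μ : ℝ) :
    (∑ j, (v j - c) ^ 2 * g j) / (J : ℝ) = (∑ j, (v j - μ) ^ 2 * g j) / (J : ℝ)
      - 2 * (c - μ) * ((∑ j, (v j - μ) * g j) / (J : ℝ)) + (c - μ) ^ 2 * ((∑ j, g j) / (J : ℝ)) := by
  rw [mul_div_assoc', mul_div_assoc', ← sub_div, ← add_div, Finset.mul_sum, Finset.mul_sum,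
    ← Finset.sum_sub_distrib, ← Finset.sum_add_distrib]
  congr 1
  exact Finset.sum_congr rfl fun j _ => by ring

theorem quadratic_growth {B t y c w : ℝ} (hB : |t| ≤ B) (hy : |y| ≤ w) :
    |(y - c) ^ 2 * t| ≤ B * (3 + 2 * c ^ 2) * (1 + w ^ 2) ∧
    |(y - c) * t| ≤ B * (3 + 2 * c ^ 2) * (1 + w ^ 2) ∧
    |t| ≤ B * (3 + 2 * c ^ 2) * (1 + w ^ 2) := by
  have hB0 : 0 ≤ B := (abs_nonneg t).trans hB
  have hyw : y ^ 2 ≤ w ^ 2 := by rw [← sq_abs]; exact pow_le_pow_left₀ (abs_nonneg _) hy 2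
  have h2 : (y - c) ^ 2 ≤ (3 + 2 * c ^ 2) * (1 + w ^ 2) - 1 := by
    nlinarith [sq_nonneg (y + c), mul_nonneg (sq_nonneg c) (sq_nonneg w), sq_nonneg w]
  have h1 : |y - c| ≤ (3 + 2 * c ^ 2) * (1 + w ^ 2) := by
    nlinarith [sq_abs (y - c), sq_nonneg (|y - c| - 1), abs_nonneg (y - c)]
  have h0 : 1 ≤ (3 + 2 * c ^ 2) * (1 + w ^ 2) := by
    nlinarith [mul_nonneg (sq_nonneg c) (sq_nonneg w), sq_nonneg w, sq_nonneg c]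
  have key : ∀ s : ℝ, |s| ≤ (3 + 2 * c ^ 2) * (1 + w ^ 2) →
      |s * t| ≤ B * (3 + 2 * c ^ 2) * (1 + w ^ 2) := by
    intro s hs
    rw [abs_mul, mul_assoc, mul_comm B]
    exact mul_le_mul hs hB (abs_nonneg _) (by positivity)
  refine ⟨key _ ?_, key _ h1, ?_⟩
  · rw [abs_of_nonneg (sq_nonneg _)]; linarith
  · have := key 1 (by rwa [abs_one])
    rwa [one_mul] at this

end Centring

/-! ### Limits of weighted variances, for the arms and for the observed values. -/

namespace RegularArray

variable {pm C : ℝ} {p : ∀ J, Fin J → I} {a b : ∀ J, Fin J → ℝ} {ν : Measure (ℝ × ℝ × ℝ)}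

theorem weighted_variance (h : RegularArray pm C p a b ν) {s : ℝ × ℝ × ℝ → ℝ} (hs : Continuous s)
    (hsb : ∀ x, |s x| ≤ max |x.2.1| |x.2.2|) {g : ℝ → ℝ} (hg : Continuous g) {B : ℝ}
    (hB : ∀ q, |g q| ≤ B) {c : ℕ → ℝ} {μ : ℝ} (hc : Tendsto c atTop (𝓝 μ)) :
    Integrable (fun x => (s x - μ) ^ 2 * g x.1) ν ∧
    Tendsto (fun J : ℕ => (∑ j, (s (sessionTriple (p J) (a J) (b J) j) - c J) ^ 2 * g (p J j))
      / (J : ℝ)) atTop (𝓝 (∫ x, (s x - μ) ^ 2 * g x.1 ∂ν)) := by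
  have h2 := h.moments (f := fun x => (s x - μ) ^ 2 * g x.1) (by fun_prop)
    fun x => (quadratic_growth (c := μ) (hB x.1) (hsb x)).1
  have h1 := h.moments (f := fun x => (s x - μ) * g x.1) (by fun_prop)
    fun x => (quadratic_growth (c := μ) (hB x.1) (hsb x)).2.1
  have h0 := h.moments (f := fun x => g x.1) (by fun_prop)
    fun x => (quadratic_growth (c := μ) (hB x.1) (hsb x)).2.2
  refine ⟨h2.1, ?_⟩
  have hc0 : Tendsto (fun J => c J - μ) atTop (𝓝 0) := by simpa using hc.sub_const μ
  have := (h2.2.sub ((hc0.const_mul 2).mul h1.2)).add ((hc0.pow 2).mul h0.2)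
  simp only [mul_zero, zero_mul, sub_zero, ne_eq, OfNat.ofNat_ne_zero, not_false_eq_true, zero_pow,
    add_zero] at this
  refine this.congr fun J => ?_
  exact (sum_centred_sq_mul_div _ _ _ _).symm

/-- A session reveals its first value with probability `p` and its second with `1 - p`; the limit
averages over this choice. -/
theorem tendstoInProb_observed (h : RegularArray pm C p a b ν) {f : ℝ → ℝ → ℝ}
    (hf : Continuous fun x : ℝ × ℝ => f x.1 x.2) {A : ℝ}
    (hA : ∀ q y w : ℝ, |y| ≤ w → |f q y| ≤ A * (1 + w ^ 2)) :
    Integrable (fun x => clampProb pm x.1 * f x.1 x.2.1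
        + (1 - clampProb pm x.1) * f x.1 x.2.2) ν ∧
    TendstoInProb (fun J => designLaw (p J))
      (fun J z => (∑ j, f (p J j) (observe (a J) (b J) z j)) / (J : ℝ))
      (∫ x, (clampProb pm x.1 * f x.1 x.2.1 + (1 - clampProb pm x.1) * f x.1 x.2.2) ∂ν) := by
  have hcl0 : ∀ q, 0 ≤ clampProb pm q := fun q => h.pm_pos.le.trans (le_clampProb _ _)
  have hcl1 : ∀ q, clampProb pm q ≤ 1 := fun q =>
    (clampProb_le h.pm_lt.le q).trans (by linarith [h.pm_pos])
  have hf1 : Continuous fun x : ℝ × ℝ × ℝ => f x.1 x.2.1 :=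
    hf.comp (f := fun x : ℝ × ℝ × ℝ => (x.1, x.2.1)) (by fun_prop)
  have hf0 : Continuous fun x : ℝ × ℝ × ℝ => f x.1 x.2.2 :=
    hf.comp (f := fun x : ℝ × ℝ × ℝ => (x.1, x.2.2)) (by fun_prop)
  have hA1 : ∀ x : ℝ × ℝ × ℝ, |f x.1 x.2.1| ≤ A * (1 + (max |x.2.1| |x.2.2|) ^ 2) := fun x =>
    hA _ _ _ (le_max_left _ _)
  have hA0 : ∀ x : ℝ × ℝ × ℝ, |f x.1 x.2.2| ≤ A * (1 + (max |x.2.1| |x.2.2|) ^ 2) := fun x =>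
    hA _ _ _ (le_max_right _ _)
  have h1 := h.moments (f := fun x => clampProb pm x.1 * f x.1 x.2.1) (by fun_prop)
    fun x => by
      rw [abs_mul, abs_of_nonneg (hcl0 _)]
      exact (mul_le_of_le_one_left (abs_nonneg _) (hcl1 _)).trans (hA1 x)
  have h0 := h.moments (f := fun x => (1 - clampProb pm x.1) * f x.1 x.2.2) (by fun_prop)
    fun x => by
      rw [abs_mul, abs_of_nonneg (sub_nonneg.2 (hcl1 _))]
      exact (mul_le_of_le_one_left (abs_nonneg _) (by linarith [hcl0 x.1])).trans (hA0 x)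
  refine ⟨h1.1.add h0.1, ?_⟩
  rw [integral_add h1.1 h0.1]
  have ep : ∀ J j, clampProb pm (p J j) = p J j := fun J j => clampProb_of_mem (h.overlap J j)
  have t1 := tendstoInProb_treatedAvg (p := p) tendsto_id (f := fun J j => f (p J j) (a J j))
    ((eventually_ge_atTop 1).mono fun J hJ => h.sq_avg_le hA1 hJ)
    (h1.2.congr fun J => by simp [sessionTriple, ep])
  have t0 := tendstoInProb_controlAvg (p := p) tendsto_id (f := fun J j => f (p J j) (b J j))
    ((eventually_ge_atTop 1).mono fun J hJ => h.sq_avg_le hA0 hJ)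
    (h0.2.congr fun J => by simp [sessionTriple, ep])
  refine (t1.add t0).congr_eventually (Eventually.of_forall fun J => ?_)
  ext z
  rw [treatedAvg, controlAvg, ← add_div, ← Finset.sum_add_distrib]
  refine congrArg (· / _) (Finset.sum_congr rfl fun j _ => ?_)
  rcases Bool.eq_false_or_eq_true (z j) with e | e <;> simp [observe, ind, e]

/-- The limit of the mean of the observed values. -/
noncomputable def observedCentre (pm : ℝ) (ν : Measure (ℝ × ℝ × ℝ)) : ℝ :=
  ∫ x, (clampProb pm x.1 * x.2.1 + (1 - clampProb pm x.1) * x.2.2) ∂ν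

/-- The limit of the weighted variance of the observed values. -/
noncomputable def observedVariance (pm : ℝ) (ν : Measure (ℝ × ℝ × ℝ)) (g : ℝ → ℝ) : ℝ :=
  ∫ x, (clampProb pm x.1 * ((x.2.1 - observedCentre pm ν) ^ 2 * g x.1)
    + (1 - clampProb pm x.1) * ((x.2.2 - observedCentre pm ν) ^ 2 * g x.1)) ∂ν

theorem tendstoInProb_observed_mean (h : RegularArray pm C p a b ν) :
    TendstoInProb (fun J => designLaw (p J))
      (fun J z => (∑ j, observe (a J) (b J) z j) / (J : ℝ)) (observedCentre pm ν) :=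
  (h.tendstoInProb_observed (f := fun _ y => y) (by fun_prop) (A := 1) fun _ y w hy => by
    nlinarith [sq_nonneg (w - 1), sq_nonneg (w + 1)]).2

theorem tendstoInProb_observed_variance (h : RegularArray pm C p a b ν) {g : ℝ → ℝ}
    (hg : Continuous g) {B : ℝ} (hB : ∀ q, |g q| ≤ B) :
    Integrable (fun x => clampProb pm x.1 * ((x.2.1 - observedCentre pm ν) ^ 2 * g x.1)
      + (1 - clampProb pm x.1) * ((x.2.2 - observedCentre pm ν) ^ 2 * g x.1)) ν ∧
    TendstoInProb (fun J => designLaw (p J))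
      (fun J z => (∑ j, (observe (a J) (b J) z j - (∑ i, observe (a J) (b J) z i) / (J : ℝ)) ^ 2
        * g (p J j)) / (J : ℝ)) (observedVariance pm ν g) := by
  set c := observedCentre pm ν with hc
  have h2 := h.tendstoInProb_observed (f := fun q y => (y - c) ^ 2 * g q) (by fun_prop)
    fun q y w hy => (quadratic_growth (c := c) (hB q) hy).1
  have h1 := h.tendstoInProb_observed (f := fun q y => (y - c) * g q) (by fun_prop)
    fun q y w hy => (quadratic_growth (c := c) (hB q) hy).2.1
  have h0 := h.tendstoInProb_observed (f := fun q _ => g q) (by fun_prop)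
    fun q y w hy => (quadratic_growth (c := c) (hB q) hy).2.2
  refine ⟨h2.1, ?_⟩
  have hm := h.tendstoInProb_observed_mean
  have key := ((h2.2.prodMk h1.2).prodMk (h0.2.prodMk hm)).comp_continuousAt
    (g := fun q : (ℝ × ℝ) × (ℝ × ℝ) => q.1.1 - 2 * (q.2.2 - c) * q.1.2 + (q.2.2 - c) ^ 2 * q.2.1)
    (by fun_prop)
  rw [← hc] at key
  simp only [sub_self, mul_zero, zero_mul, sub_zero, ne_eq, OfNat.ofNat_ne_zero, not_false_eq_true,
    zero_pow, add_zero] at key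
  refine key.congr_eventually (Eventually.of_forall fun J => ?_)
  ext z
  exact (sum_centred_sq_mul_div _ _ _ _).symm

end RegularArray

/-- The two roots multiply to one, leaving the cross term `2 s t`. This identifies `sigmaReg` with
the limit variance in the central limit theorem. -/
theorem sq_sqrt_odds_add {q s t : ℝ} (h0 : 0 < q) (h1 : q < 1) :
    (√((1 - q) / q) * s + √(q / (1 - q)) * t) ^ 2 = s ^ 2 / q + t ^ 2 / (1 - q) - (s - t) ^ 2 := by
  have h1' : 0 < 1 - q := by linarith
  have e : √((1 - q) / q) * √(q / (1 - q)) = 1 := by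
    rw [← Real.sqrt_mul (by positivity), div_mul_div_comm, mul_comm q, div_self (by positivity),
      Real.sqrt_one]
  have e1 := Real.sq_sqrt (show 0 ≤ (1 - q) / q by positivity)
  have e0 := Real.sq_sqrt (show 0 ≤ q / (1 - q) by positivity)
  calc _ = √((1 - q) / q) ^ 2 * s ^ 2 + 2 * (√((1 - q) / q) * √(q / (1 - q))) * (s * t)
        + √(q / (1 - q)) ^ 2 * t ^ 2 := by ring
    _ = _ := by
        rw [e, e1, e0]
        field_simp
        ring

/-- The randomization tail probability of the observed statistic when the observed values are held
fixed. -/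
noncomputable def tailProb {J : ℕ} (p : Fin J → I) (y : Fin J → ℝ) (t : ℝ) : ℝ :=
  (designLaw p).real {z | t ≤ tReg p y z}

/-! ### Limit law of the randomization tail probability. -/

namespace RegularArray

variable {pm C : ℝ} {p : ∀ J, Fin J → I} {a b : ∀ J, Fin J → ℝ} {ν : Measure (ℝ × ℝ × ℝ)}

theorem tendsto_mean (h : RegularArray pm C p a b ν) {s : ℝ × ℝ × ℝ → ℝ} (hs : Continuous s)
    (hsb : ∀ x, |s x| ≤ max |x.2.1| |x.2.2|) :
    Integrable s ν ∧ Tendsto (fun J : ℕ => (∑ j, s (sessionTriple (p J) (a J) (b J) j)) / (J : ℝ))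
      atTop (𝓝 (∫ x, s x ∂ν)) :=
  h.moments hs (A := 1) fun x => (hsb x).trans (by
    nlinarith [sq_nonneg (max |x.2.1| |x.2.2| - 1), sq_nonneg (max |x.2.1| |x.2.2|)])

theorem tendsto_mean1 (h : RegularArray pm C p a b ν) :
    Tendsto (fun J : ℕ => (∑ j, a J j) / (J : ℝ)) atTop (𝓝 (mean1 ν)) :=
  (h.tendsto_mean (s := fun x => x.2.1) (by fun_prop) fun _ => le_max_left _ _).2

/-- The weak null equates the arm sums, so the treated mean also tends to the control limit and one
centre serves both arms. -/
theorem tendsto_mean0 (h : RegularArray pm C p a b ν) :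
    Tendsto (fun J : ℕ => (∑ j, a J j) / (J : ℝ)) atTop (𝓝 (mean0 ν)) := by
  simp_rw [h.balanced]
  exact (h.tendsto_mean (s := fun x => x.2.2) (by fun_prop) fun _ => le_max_right _ _).2

theorem mean1_eq_mean0 (h : RegularArray pm C p a b ν) : mean1 ν = mean0 ν :=
  tendsto_nhds_unique h.tendsto_mean1 h.tendsto_mean0

theorem continuous_inv_clampProb (hpm : 0 < pm) : Continuous fun q => (clampProb pm q)⁻¹ :=
  (continuous_clampProb pm).inv₀ fun q => (hpm.trans_le (le_clampProb pm q)).ne'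

theorem continuous_inv_one_sub_clampProb (hpm : 0 < pm) (hpm' : pm < 1 / 2) :
    Continuous fun q => (1 - clampProb pm q)⁻¹ := by
  have hc : Continuous fun q => 1 - clampProb pm q :=
    continuous_const.sub (continuous_clampProb pm)
  exact hc.inv₀ fun q => (show 0 < 1 - clampProb pm q by linarith [clampProb_le hpm'.le q]).ne'

theorem abs_inv_clampProb_le (hpm : 0 < pm) (q : ℝ) : |(clampProb pm q)⁻¹| ≤ pm⁻¹ := by
  have := le_clampProb pm q
  have := hpm.trans_le this
  rw [abs_of_nonneg (by positivity)]
  gcongr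

theorem abs_inv_one_sub_clampProb_le (hpm : 0 < pm) (hpm' : pm < 1 / 2) (q : ℝ) :
    |(1 - clampProb pm q)⁻¹| ≤ pm⁻¹ := by
  have : pm ≤ 1 - clampProb pm q := by linarith [clampProb_le hpm'.le q]
  have := hpm.trans_le this
  rw [abs_of_nonneg (by positivity)]
  gcongr

/-- The limiting variances of the weighted arms, and of the unit-level effects. -/
theorem variance_limits (h : RegularArray pm C p a b ν) : ∃ u1 u0 w : ℝ,
    Tendsto (fun J : ℕ => (∑ j, (a J j - (∑ i, a J i) / (J : ℝ)) ^ 2 / (p J j : ℝ)) / (J : ℝ)) atTop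
      (𝓝 u1) ∧
    Tendsto (fun J : ℕ => (∑ j, (b J j - (∑ i, a J i) / (J : ℝ)) ^ 2 / (1 - (p J j : ℝ))) / (J : ℝ))
      atTop (𝓝 u0) ∧
    Tendsto (fun J : ℕ => (∑ j, (a J j - b J j) ^ 2) / (J : ℝ)) atTop (𝓝 w) ∧
    0 ≤ w ∧ sigmaUpReg ν = u1 + u0 ∧ sigmaReg ν = u1 + u0 - w := by
  have ep : ∀ J j, clampProb pm (p J j) = p J j := fun J j => clampProb_of_mem (h.overlap J j)
  have h1 := h.weighted_variance (s := fun x => x.2.1) (by fun_prop) (fun _ => le_max_left _ _)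
    (continuous_inv_clampProb h.pm_pos) (abs_inv_clampProb_le h.pm_pos) h.tendsto_mean1
  have h0 := h.weighted_variance (s := fun x => x.2.2) (by fun_prop) (fun _ => le_max_right _ _)
    (continuous_inv_one_sub_clampProb h.pm_pos h.pm_lt)
    (abs_inv_one_sub_clampProb_le h.pm_pos h.pm_lt) h.tendsto_mean0
  have hw := h.moments (f := fun x => (x.2.1 - x.2.2) ^ 2) (by fun_prop) (A := 4) fun x => by
    rw [abs_of_nonneg (sq_nonneg _)]
    have e1 := pow_le_pow_left₀ (abs_nonneg _) (le_max_left |x.2.1| |x.2.2|) 2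
    have e0 := pow_le_pow_left₀ (abs_nonneg _) (le_max_right |x.2.1| |x.2.2|) 2
    rw [sq_abs] at e1 e0
    nlinarith [sq_nonneg (x.2.1 + x.2.2)]
  refine ⟨_, _, _, h1.2.congr fun J => ?_, h0.2.congr fun J => ?_, hw.2,
    integral_nonneg fun x => sq_nonneg _, ?_, ?_⟩
  · simp [sessionTriple, ep, div_eq_mul_inv]
  · simp [sessionTriple, ep, div_eq_mul_inv]
  · rw [← integral_add h1.1 h0.1, sigmaUpReg]
    refine integral_congr_ae ?_
    filter_upwards [h.support] with x hx
    rw [clampProb_of_mem hx, div_eq_mul_inv, div_eq_mul_inv]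
  · have hadd : Integrable (fun x : ℝ × ℝ × ℝ => (x.2.1 - mean1 ν) ^ 2 * (clampProb pm x.1)⁻¹
        + (x.2.2 - mean0 ν) ^ 2 * (1 - clampProb pm x.1)⁻¹) ν := h1.1.add h0.1
    rw [← integral_add h1.1 h0.1, ← integral_sub hadd hw.1, sigmaReg]
    refine integral_congr_ae ?_
    filter_upwards [h.support] with x hx
    rw [clampProb_of_mem hx,
      sq_sqrt_odds_add (h.pm_pos.trans_le hx.1) (by linarith [h.pm_pos, hx.2]),
      h.mean1_eq_mean0, div_eq_mul_inv, div_eq_mul_inv]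
    ring

theorem sigmaReg_le (h : RegularArray pm C p a b ν) : sigmaReg ν ≤ sigmaUpReg ν := by
  obtain ⟨u1, u0, w, -, -, -, hw, e1, e2⟩ := h.variance_limits
  linarith

/-- The observed studentized statistic is asymptotically Gaussian. -/
theorem tendstoInDistribution_tReg_observe (h : RegularArray pm C p a b ν)
    (hup : 0 < sigmaUpReg ν) :
    TendstoInDistribution (fun J z => tReg (p J) (observe (a J) (b J) z) z) atTop
      (fun x => √(sigmaReg ν / sigmaUpReg ν) * x) (fun J => designLaw (p J))
      (gaussianReal 0 1) := by
  obtain ⟨u1, u0, w, h1, h0, hw, -, e1, e2⟩ := h.variance_limits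
  rw [e1] at hup
  rw [e1, e2]
  have hsum : ∀ {v : ∀ J, Fin J → ℝ}, (∀ J, ∑ j, v J j = ∑ j, a J j) →
      ∀ᶠ J : ℕ in atTop, ∑ j, (v J j - (∑ i, a J i) / (J : ℝ)) = 0 := by
    intro v hv
    filter_upwards [eventually_gt_atTop 0] with J hJ
    have : (J : ℝ) ≠ 0 := by exact_mod_cast hJ.ne'
    rw [Finset.sum_sub_distrib, hv]
    simp
    field_simp
    simp
  refine tendstoInDistribution_tReg (N := fun J => J) tendsto_id h.pm_pos h.overlap
    (hsum fun _ => rfl) (hsum fun J => (h.balanced J).symm) (C := 16 * C) ?_ ?_ h1 h0 hw hup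
  · filter_upwards [eventually_ge_atTop 1] with J hJ
    exact sum_centred_pow_four_div_le hJ (fun _ => le_max_left _ _) (h.fourth_moment J hJ)
  · filter_upwards [eventually_ge_atTop 1] with J hJ
    rw [h.balanced]
    exact sum_centred_pow_four_div_le hJ (fun _ => le_max_right _ _) (h.fourth_moment J hJ)

theorem observedVariance_nonneg (h : RegularArray pm C p a b ν) {g : ℝ → ℝ}
    (hg : ∀ q, 0 ≤ g q) : 0 ≤ observedVariance pm ν g := by
  refine integral_nonneg fun x => ?_
  have h1 := h.pm_pos.le.trans (le_clampProb pm x.1)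
  have h0 : 0 ≤ 1 - clampProb pm x.1 := by linarith [clampProb_le h.pm_lt.le x.1, h.pm_pos]
  have := hg x.1
  simp only [Pi.zero_apply]
  positivity

/-- Both arms have positive weight in the observed mixture. If its variance vanished, both values
would almost surely equal one constant and `sigmaUpReg` would be zero. -/
theorem observedVariance_pos (h : RegularArray pm C p a b ν) (hup : 0 < sigmaUpReg ν) :
    0 < observedVariance pm ν fun q => (clampProb pm q)⁻¹ := by
  have hcl : ∀ q, 0 < clampProb pm q := fun q => h.pm_pos.trans_le (le_clampProb pm q)
  have hcl' : ∀ q, 0 < 1 - clampProb pm q := fun q => by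
    linarith [clampProb_le h.pm_lt.le q, h.pm_pos]
  have := h.prob
  refine lt_of_le_of_ne (h.observedVariance_nonneg fun q => (inv_pos.2 (hcl q)).le) fun hz => ?_
  have hi := (h.tendstoInProb_observed_variance (continuous_inv_clampProb h.pm_pos)
    (abs_inv_clampProb_le h.pm_pos)).1
  have hae := (integral_eq_zero_iff_of_nonneg (fun x => by
    have := hcl x.1
    have := hcl' x.1
    simp only [Pi.zero_apply]
    positivity) hi).1 hz.symm
  set c := observedCentre pm ν
  have hc : ∀ᵐ x ∂ν, x.2.1 = c ∧ x.2.2 = c := by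
    filter_upwards [hae] with x hx
    have p1 := hcl x.1
    have p0 := hcl' x.1
    simp only [Pi.zero_apply] at hx
    rw [add_eq_zero_iff_of_nonneg (by positivity) (by positivity)] at hx
    simpa [p1.ne', p0.ne', sub_eq_zero] using hx
  have m1 : mean1 ν = c := by
    rw [mean1, integral_congr_ae (g := fun _ => c) (hc.mono fun x hx => hx.1)]; simp
  have m0 : mean0 ν = c := by
    rw [mean0, integral_congr_ae (g := fun _ => c) (hc.mono fun x hx => hx.2)]; simp
  have : sigmaUpReg ν = 0 := by
    rw [sigmaUpReg, integral_congr_ae (g := fun _ => (0 : ℝ)) (hc.mono fun x hx => by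
      simp [m1, m0, hx.1, hx.2])]
    simp
  exact hup.ne' this

/-- With probability tending to one the observed values meet the moment conditions of the uniform
approximation. Uniformity in the threshold then allows the data-dependent one. -/
theorem tendstoInProb_tailProb_sub (h : RegularArray pm C p a b ν) (hup : 0 < sigmaUpReg ν) :
    TendstoInProb (fun J => designLaw (p J)) (fun J z =>
      tailProb (p J) (observe (a J) (b J) z) (tReg (p J) (observe (a J) (b J) z) z)
        - gaussianTail (tReg (p J) (observe (a J) (b J) z) z)) 0 := by
  intro ε hε
  have hpos := add_pos_of_pos_of_nonneg (h.observedVariance_pos hup)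
    (h.observedVariance_nonneg (g := fun q => (1 - clampProb pm q)⁻¹) fun q =>
      inv_nonneg.2 (by linarith [clampProb_le h.pm_lt.le q, h.pm_pos]))
  obtain ⟨δ, hδ, J0, hJ0⟩ := exists_forall_abs_tail_tReg_sub_le h.pm_pos h.overlap (16 * C) hpos
    (half_pos hε)
  have t1 := (h.tendstoInProb_observed_variance (continuous_inv_clampProb h.pm_pos)
    (abs_inv_clampProb_le h.pm_pos)).2 δ hδ
  have t0 := (h.tendstoInProb_observed_variance
    (continuous_inv_one_sub_clampProb h.pm_pos h.pm_lt)
    (abs_inv_one_sub_clampProb_le h.pm_pos h.pm_lt)).2 δ hδ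
  have ep : ∀ J j, clampProb pm (p J j) = p J j := fun J j => clampProb_of_mem (h.overlap J j)
  simp only [ep, ← div_eq_mul_inv] at t1 t0
  have t := t1.add t0
  rw [add_zero] at t
  refine tendsto_of_tendsto_of_tendsto_of_le_of_le' tendsto_const_nhds t
    (Eventually.of_forall fun _ => zero_le) ?_
  filter_upwards [eventually_ge_atTop 1, eventually_ge_atTop J0] with J hJ1 hJ
  refine (measure_mono fun z hz => ?_).trans (measure_union_le _ _)
  by_contra hcon
  simp only [Set.mem_union, Set.mem_ofPred_eq, not_or, not_le, Real.dist_eq] at hcon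
  have hb := hJ0 J hJ (observe (a J) (b J) z) (sum_centred_pow_four_div_le hJ1 (fun j => by
    unfold observe
    split_ifs
    exacts [le_max_left _ _, le_max_right _ _]) (h.fourth_moment J hJ1)) hcon.1.le hcon.2.le
    (tReg (p J) (observe (a J) (b J) z) z)
  simp only [Set.mem_ofPred_eq, dist_zero_right, Real.norm_eq_abs] at hz
  have := hz.trans hb
  linarith

theorem tendstoInDistribution_tailProb (h : RegularArray pm C p a b ν) (hup : 0 < sigmaUpReg ν) :
    TendstoInDistribution (fun J z =>
      tailProb (p J) (observe (a J) (b J) z) (tReg (p J) (observe (a J) (b J) z) z)) atTop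
      (fun x => gaussianTail (√(sigmaReg ν / sigmaUpReg ν) * x)) (fun J => designLaw (p J))
      (gaussianReal 0 1) := by
  have h1 := (h.tendstoInDistribution_tReg_observe hup).continuous_comp continuous_gaussianTail
  have h2 := h.tendstoInProb_tailProb_sub hup
  exact TendstoInDistribution.congr_prob h1 h2

theorem tendsto_integral_comp_tailProb (h : RegularArray pm C p a b ν) (hup : 0 < sigmaUpReg ν)
    {g : ℝ → ℝ} (hg : Continuous g) :
    Tendsto (fun J => ∫ z, g (tailProb (p J) (observe (a J) (b J) z)
      (tReg (p J) (observe (a J) (b J) z) z)) ∂(designLaw (p J))) atTop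
      (𝓝 (∫ x, g (gaussianTail (√(sigmaReg ν / sigmaUpReg ν) * x)) ∂(gaussianReal 0 1))) := by
  have hT := h.tendstoInDistribution_tailProb hup
  obtain ⟨K, hK⟩ := (isCompact_Icc (a := (0 : ℝ)) (b := 1)).exists_bound_of_continuousOn
    hg.continuousOn
  -- Tail probabilities lie in `[0, 1]`, so `g` may be made bounded by freezing it outside that
  -- interval.
  let G : BoundedContinuousFunction ℝ ℝ := BoundedContinuousFunction.ofNormedAddCommGroup
    (fun x => g (max 0 (min 1 x))) (by fun_prop) K
    (fun x => hK _ ⟨le_max_left _ _, max_le zero_le_one (min_le_left _ _)⟩)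
  have hG : ∀ x, 0 ≤ x → x ≤ 1 → G x = g x := fun x h0 h1 => by
    change g (max 0 (min 1 x)) = g x
    rw [min_eq_right h1, max_eq_right h0]
  have hlim := (ProbabilityMeasure.tendsto_iff_forall_integral_tendsto.1 hT.tendsto) G
  simp only [ProbabilityMeasure.coe_mk] at hlim
  rw [integral_map hT.aemeasurable_limit G.continuous.aestronglyMeasurable] at hlim
  convert hlim using 2 with J
  · rw [integral_map (hT.forall_aemeasurable J) G.continuous.aestronglyMeasurable]
    exact integral_congr_ae (Eventually.of_forall fun z =>
      (hG _ measureReal_nonneg measureReal_le_one).symm)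
  · exact integral_congr_ae (Eventually.of_forall fun x =>
      (hG _ (gaussianTail_nonneg _) (gaussianTail_le_one _)).symm)

end RegularArray

/-! ### The exact conditional law of the Monte Carlo p-value, and the reduction to session arrays.
-/

open Classical in
/-- The number of independent draws that fall in a set is binomial. -/
theorem pi_real_card_filter_lt {Ω : Type*} [MeasurableSpace Ω] (μ : Measure Ω)
    [IsProbabilityMeasure μ] {A : Set Ω} (hA : MeasurableSet A) (M k : ℕ) :
    (Measure.pi fun _ : Fin M => μ).real
      {zs | (Finset.univ.filter fun b => zs b ∈ A).card < k} = binomialLower M k (μ.real A) := by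
  -- The event is partitioned by the exact set `S` of successful draws; each piece is a box, whose
  -- probability depends only on `S.card`.
  have hS : ∀ S : Finset (Fin M), {zs : Fin M → Ω | (Finset.univ.filter fun b => zs b ∈ A) = S}
      = Set.univ.pi fun b => if b ∈ S then A else Aᶜ := fun S => by
    ext zs
    simp only [Set.mem_ofPred_eq, Finset.ext_iff, Finset.mem_filter, Finset.mem_univ, true_and,
      Set.mem_univ_pi]
    refine forall_congr' fun b => ?_
    by_cases hb : b ∈ S <;> simp [hb]
  have hm : ∀ S : Finset (Fin M),
      MeasurableSet {zs : Fin M → Ω | (Finset.univ.filter fun b => zs b ∈ A) = S} := fun S => by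
    rw [hS]
    refine MeasurableSet.univ_pi fun b => ?_
    split_ifs
    exacts [hA, hA.compl]
  have hr : ∀ S : Finset (Fin M), (Measure.pi fun _ : Fin M => μ).real
      {zs : Fin M → Ω | (Finset.univ.filter fun b => zs b ∈ A) = S}
      = μ.real A ^ S.card * (1 - μ.real A) ^ (M - S.card) := fun S => by
    rw [hS, measureReal_def, Measure.pi_pi, ENNReal.toReal_prod]
    have : ∀ b, (μ (if b ∈ S then A else Aᶜ)).toReal
        = if b ∈ S then μ.real A else 1 - μ.real A := fun b => by
      split_ifs
      · rfl
      · exact probReal_compl_eq_one_sub hA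
    simp only [this, Finset.prod_ite, Finset.prod_const, Finset.filter_mem_eq_inter,
      Finset.univ_inter]
    congr 2
    rw [Finset.filter_not, Finset.filter_mem_eq_inter, Finset.univ_inter,
      ← Finset.compl_eq_univ_sdiff, Finset.card_compl, Fintype.card_fin]
  have hU : {zs : Fin M → Ω | (Finset.univ.filter fun b => zs b ∈ A).card < k}
      = ⋃ S ∈ (Finset.univ : Finset (Finset (Fin M))).filter fun S => S.card < k,
        {zs : Fin M → Ω | (Finset.univ.filter fun b => zs b ∈ A) = S} := by
    ext zs
    simp
  rw [hU, measureReal_biUnion_finset (fun S _ T _ hST => ?_) fun S _ => hm S]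
  · simp only [hr]
    rw [binomialLower, ← Finset.sum_fiberwise_of_maps_to (g := Finset.card) (t := Finset.range k)
      (by simp)]
    refine Finset.sum_congr rfl fun i hi => ?_
    rw [bernsteinPolynomial_eval]
    have : ((Finset.univ : Finset (Finset (Fin M))).filter fun S => S.card < k).filter
        (fun S => S.card = i) = Finset.powersetCard i Finset.univ := by
      ext S
      have := Finset.mem_range.1 hi
      simp only [Finset.mem_filter, Finset.mem_univ, true_and, Finset.mem_powersetCard,
        Finset.subset_univ]
      omega
    rw [this, Finset.sum_congr rfl (g := fun _ => μ.real A ^ i * (1 - μ.real A) ^ (M - i))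
      fun S hS => by
        rw [(Finset.mem_powersetCard.1 hS).2], Finset.sum_const, Finset.card_powersetCard,
      Finset.card_univ, Fintype.card_fin, nsmul_eq_mul, mul_assoc]
  · exact Set.disjoint_left.2 fun zs h h' => hST (h.symm.trans h')

variable {J L : ℕ}

open Classical in
-- The added one in the p-value turns the bound on the count into a strict inequality.
theorem pValue_le_iff {M : ℕ} (m : ℕ) (p : Fin J → I) (Y : PotentialOutcomes (J * L)) {α : ℝ}
    (hα : 0 ≤ α) (z : Fin J → Bool) (zs : Fin M → Fin J → Bool) :
    pValue m p Y z zs ≤ α ↔ (Finset.univ.filter fun b : Fin M =>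
      zs b ∈ {z' | tReg p (observedMean m Y z) z ≤ tReg p (observedMean m Y z) z'}).card
        < ⌊α * (M + 1)⌋₊ := by
  have hM : (0 : ℝ) < M + 1 := by positivity
  rw [pValue, div_le_iff₀ hM, Nat.lt_iff_add_one_le, Nat.le_floor_iff (by positivity)]
  push_cast
  exact Iff.rfl

/-- By Fubini the realized labels may be fixed; the resamples are then independent trials with
success probability `tailProb`. -/
theorem monteCarloLaw_pValue_le {M : ℕ} (m : ℕ) (p : Fin J → I) (Y : PotentialOutcomes (J * L))
    {α : ℝ} (hα : 0 ≤ α) :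
    monteCarloLaw M p {ω | pValue m p Y ω.1 ω.2 ≤ α} = ENNReal.ofReal
      (∫ z, binomialLower M ⌊α * (M + 1)⌋₊
        (tailProb p (observedMean m Y z) (tReg p (observedMean m Y z) z)) ∂(designLaw p)) := by
  have hz : ∀ z, (Measure.pi fun _ : Fin M => designLaw p)
      (Prod.mk z ⁻¹' {ω | pValue m p Y ω.1 ω.2 ≤ α}) = ENNReal.ofReal
      (binomialLower M ⌊α * (M + 1)⌋₊
        (tailProb p (observedMean m Y z) (tReg p (observedMean m Y z) z))) := fun z => by
    rw [tailProb, ← pi_real_card_filter_lt _ .of_discrete, measureReal_def,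
      ENNReal.ofReal_toReal (measure_ne_top _ _)]
    congr 1
    ext zs
    exact pValue_le_iff m p Y hα z zs
  rw [monteCarloLaw, Measure.prod_apply .of_discrete, ofReal_integral_eq_lintegral_ofReal]
  · simp only [hz]
  · exact .of_finite
  · refine Eventually.of_forall fun z => ?_
    change 0 ≤ binomialLower _ _ _
    rw [tailProb, ← pi_real_card_filter_lt _ .of_discrete]
    exact measureReal_nonneg

theorem observedMean_eq {m : ℕ} {Y : PotentialOutcomes (J * L)} (hna : NonAnticipating Y)
    (hc : MCarryover m Y) (z : Fin J → Bool) :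
    observedMean m Y z = observe (sessionPO m Y true) (sessionPO m Y false) z := by
  have key : ∀ j, ∀ t ∈ focalWindow J L m j, Y t (sessionPath z) = Y t fun _ => z j := by
    intro j t ht
    obtain ⟨h1, h2⟩ := (Finset.mem_filter.1 ht).2
    have hL : 0 < L := by
      rcases Nat.eq_zero_or_pos L with rfl | h
      · simp at h2
      · exact h
    -- The intermediate path is constant up to `t` and follows the labels afterwards.
    -- Non-anticipation links it to the constant path and bounded carryover to the actual one, since
    -- the `m` periods before a focal period lie in its own session.
    rw [hna t (fun _ => z j) (fun s => if s ≤ t then z j else sessionPath z s)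
      fun s hs => by simp [hs]]
    refine hc t (le_trans (Nat.le_add_left _ _) h1) _ _ fun s hs => ?_
    split_ifs with hst
    · rw [sessionPath]
      congr 1
      ext
      rw [Fin.coe_divNat]
      have hst' : (s : ℕ) ≤ t := hst
      exact Nat.div_eq_of_lt_le (by linarith) (by linarith)
    · rfl
  funext j
  rw [observedMean, focalMean, Finset.sum_congr rfl (key j), observe]
  cases z j <;> rfl

theorem WeakNullAsymptotics.exists_regularArray {m : ℕ} {pmin : ℝ} {p : (J : ℕ) → Fin J → I}
    {Y : (J : ℕ) → PotentialOutcomes (J * L)} {ν : Measure (ℝ × ℝ × ℝ)}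
    (h : WeakNullAsymptotics L m pmin p Y ν) (hnull : ∀ J : ℕ, focalEffect m (Y J) = 0) :
    ∃ C, RegularArray pmin C p (fun J => sessionPO m (Y J) true)
      (fun J => sessionPO m (Y J) false) ν := by
  obtain ⟨C, hC⟩ := h.fourth_moment
  refine ⟨C, ⟨h.pmin_pos, h.pmin_lt, h.overlap, hC, h.limit_prob, h.limit_support, fun f => ?_,
    fun J => ?_⟩⟩
  · have := h.stabilization f
    simp only [integral_empiricalMeasure] at this
    exact this
  · have := hnull J
    -- Without sessions the effect is `0 / 0` and says nothing, but both sums are empty.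
    rcases Nat.eq_zero_or_pos J with rfl | hJ
    · simp
    · rw [focalEffect, div_eq_zero_iff, Finset.sum_sub_distrib, sub_eq_zero] at this
      exact this.resolve_right (by positivity)

/-- The piecewise linear function that drops from `1` to `0` on `[β - ε, β]`. -/
noncomputable def ramp (β ε q : ℝ) : ℝ := max 0 (min 1 ((β - q) / ε))

theorem continuous_ramp (β ε : ℝ) : Continuous (ramp β ε) := by
  unfold ramp
  fun_prop

theorem ramp_of_le {β ε q : ℝ} (hε : 0 < ε) (h : β ≤ q) : ramp β ε q = 0 :=
  max_eq_left ((min_le_right _ _).trans (div_nonpos_of_nonpos_of_nonneg (by linarith) hε.le))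

theorem ramp_of_add_le {β ε q : ℝ} (hε : 0 < ε) (h : q + ε ≤ β) : ramp β ε q = 1 := by
  rw [ramp, min_eq_left ((one_le_div hε).2 (by linarith)), max_eq_right zero_le_one]

theorem integral_ramp_le {β ε : ℝ} (hε : 0 < ε) (h0 : 0 ≤ β) (h1 : β ≤ 1) :
    ∫ q in (0 : ℝ)..1, ramp β ε q ≤ β := by
  have hi := fun x y => (continuous_ramp β ε).intervalIntegrable (μ := volume) x y
  rw [← intervalIntegral.integral_add_adjacent_intervals (hi 0 β) (hi β 1)]
  have e1 : ∫ q in (0 : ℝ)..β, ramp β ε q ≤ ∫ _ in (0 : ℝ)..β, (1 : ℝ) :=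
    intervalIntegral.integral_mono_on h0 (hi 0 β) intervalIntegrable_const fun q _ =>
      max_le zero_le_one (min_le_left _ _)
  have e2 : ∫ q in β..1, ramp β ε q = ∫ _ in β..1, (0 : ℝ) :=
    intervalIntegral.integral_congr fun q hq => by
      rw [Set.uIcc_of_le h1] at hq
      exact ramp_of_le hε hq.1
  rw [intervalIntegral.integral_const] at e1
  rw [e2, intervalIntegral.integral_const]
  simpa using e1

/-- For `β ≤ 1/2` the reflected terms vanish, and the ramp itself is decreasing. -/
theorem ramp_symm_antitone {β ε : ℝ} (hε : 0 < ε) (hβ : β ≤ 1 / 2) {x y : ℝ} (hxy : x ≤ y)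
    (hy : y ≤ 1 / 2) : ramp β ε y + ramp β ε (1 - y) ≤ ramp β ε x + ramp β ε (1 - x) := by
  rw [ramp_of_le hε (show β ≤ 1 - y by linarith), ramp_of_le hε (show β ≤ 1 - x by linarith)]
  unfold ramp
  gcongr

theorem floor_mul_add_one_le {α : ℝ} (hα : 0 ≤ α) (M : ℕ) :
    (⌊α * (M + 1)⌋₊ : ℝ) ≤ α * (M + 1) :=
  Nat.floor_le (by positivity)

theorem floor_mul_add_one_le_nat {α : ℝ} (hα : 0 ≤ α) (hα' : α ≤ 1) (M : ℕ) :
    ⌊α * (M + 1)⌋₊ ≤ M + 1 := by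
  have h := floor_mul_add_one_le hα M
  have : (⌊α * (M + 1)⌋₊ : ℝ) ≤ (M + 1 : ℕ) := by
    push_cast
    nlinarith [(Nat.cast_nonneg M : (0 : ℝ) ≤ M)]
  exact_mod_cast this

/-- For many draws, the binomial lower tail at level `α` is close to a step at `α`. -/
theorem binomialLower_floor_le_ramp {α ε : ℝ} (hα : 0 ≤ α) (hα' : α ≤ 1) (hε : 0 < ε) {M : ℕ}
    (hM : 1 / ε ^ 3 ≤ M) {q : ℝ} (h0 : 0 ≤ q) (h1 : q ≤ 1) :
    binomialLower M ⌊α * (M + 1)⌋₊ q ≤ ramp (α + 2 * ε) ε q + ε := by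
  have hk := floor_mul_add_one_le_nat hα hα' M
  have hMr : (0 : ℝ) < M := lt_of_lt_of_le (by positivity) hM
  -- Up to `α + ε` the ramp equals one; beyond, the success probability exceeds the level by `ε`,
  -- and `M ≥ ε⁻³` makes the Chebyshev bound at most `ε`.
  rcases le_total q (α + ε) with hq | hq
  · rw [ramp_of_add_le hε (by linarith)]
    linarith [binomialLower_le_one hk h0 h1]
  · have hb := binomialLower_le (by exact_mod_cast hMr) hk (a := α) hε (fun i hi => by
      have hi' : (i : ℝ) + 1 ≤ ⌊α * (M + 1)⌋₊ := by exact_mod_cast hi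
      linarith [floor_mul_add_one_le hα M]) h1 h0 hq
    have hr : 0 ≤ ramp (α + 2 * ε) ε q := le_max_left _ _
    have : 1 / (M * ε ^ 2) ≤ ε := by
      rw [div_le_iff₀ (by positivity)] at hM ⊢
      linarith [show ε * (M * ε ^ 2) = M * ε ^ 3 by ring]
    linarith

/-! ### Asymptotic level of the test for arbitrary numbers of resamples. -/

namespace RegularArray

variable {pm C : ℝ} {p : ∀ J, Fin J → I} {a b : ∀ J, Fin J → ℝ} {ν : Measure (ℝ × ℝ × ℝ)}

theorem eventually_integral_comp_tailProb_le (h : RegularArray pm C p a b ν)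
    (hup : 0 < sigmaUpReg ν) {g : ℝ → ℝ} (hg : Continuous g)
    (hs : sigmaReg ν = sigmaUpReg ν ∨
      ∀ x y, 0 ≤ x → x ≤ y → y ≤ 1 / 2 → g y + g (1 - y) ≤ g x + g (1 - x))
    {ε : ℝ} (hε : 0 < ε) :
    ∀ᶠ J in atTop, ∫ z, g (tailProb (p J) (observe (a J) (b J) z)
      (tReg (p J) (observe (a J) (b J) z) z)) ∂(designLaw (p J)) ≤ (∫ t in (0 : ℝ)..1, g t) + ε := by
  have hle := integral_comp_gaussianTail_mul_le hg (r := √(sigmaReg ν / sigmaUpReg ν))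
    (Real.sqrt_nonneg _) (Real.sqrt_le_one.2 ((div_le_one hup).2 h.sigmaReg_le))
    (hs.imp_left fun e => by rw [e, div_self hup.ne', Real.sqrt_one])
  exact (h.tendsto_integral_comp_tailProb hup hg).eventually_le_const (by linarith)

/-- Monte Carlo tests calibrated by the randomization distribution are asymptotically valid. -/
theorem eventually_integral_binomialLower_le (h : RegularArray pm C p a b ν)
    (hup : 0 < sigmaUpReg ν) {α : ℝ} (hα : 0 < α)
    (hs : (sigmaReg ν = sigmaUpReg ν ∧ α < 1) ∨ α < 1 / 2) (M : ℕ → ℕ) {ε : ℝ} (hε : 0 < ε) :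
    ∀ᶠ J in atTop, ∫ z, binomialLower (M J) ⌊α * (M J + 1)⌋₊
      (tailProb (p J) (observe (a J) (b J) z) (tReg (p J) (observe (a J) (b J) z) z))
        ∂(designLaw (p J)) ≤ α + ε := by
  have hα1 : α < 1 := by rcases hs with hs | hs <;> linarith
  -- The total error is `4 δ`: `2 δ` from the widened ramp, `δ` from the binomial approximation and
  -- `δ` from the limit. The ramp's endpoint must stay below `1/2` when symmetrization is needed.
  obtain ⟨δ, hδ, hδε, hδ1, hδs⟩ : ∃ δ, 0 < δ ∧ 4 * δ ≤ ε ∧ α + 2 * δ ≤ 1 ∧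
      (sigmaReg ν = sigmaUpReg ν ∨ α + 2 * δ ≤ 1 / 2) := by
    rcases hs with ⟨e, h1⟩ | h1
    · exact ⟨min (ε / 4) ((1 - α) / 2), lt_min (by linarith) (by linarith),
        by linarith [min_le_left (ε / 4) ((1 - α) / 2)],
        by linarith [min_le_right (ε / 4) ((1 - α) / 2)], .inl e⟩
    · exact ⟨min (ε / 4) ((1 / 2 - α) / 2), lt_min (by linarith) (by linarith),
        by linarith [min_le_left (ε / 4) ((1 / 2 - α) / 2)],
        by linarith [min_le_right (ε / 4) ((1 / 2 - α) / 2)],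
        .inr (by linarith [min_le_right (ε / 4) ((1 / 2 - α) / 2)])⟩
  obtain ⟨N, hN⟩ := exists_nat_ge (1 / δ ^ 3)
  have hlarge := h.eventually_integral_comp_tailProb_le hup (continuous_ramp (α + 2 * δ) δ)
    (hδs.imp_right fun e x y _ hxy hy => ramp_symm_antitone hδ e hxy hy) hδ
  -- Below the threshold `N` only finitely many values of `M J` occur, so one `J` onwards serves all
  -- of them.
  have hsmall : ∀ᶠ J in atTop, ∀ n ∈ Finset.range N, ∫ z, binomialLower n ⌊α * (n + 1)⌋₊
      (tailProb (p J) (observe (a J) (b J) z) (tReg (p J) (observe (a J) (b J) z) z))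
        ∂(designLaw (p J)) ≤ α + ε := by
    rw [Finset.eventually_all]
    intro n _
    have hfl := floor_mul_add_one_le hα.le n
    have hn : (0 : ℝ) < n + 1 := by positivity
    filter_upwards [h.eventually_integral_comp_tailProb_le hup
      (continuous_binomialLower n ⌊α * (n + 1)⌋₊) (hs.imp (fun e => e.1) fun e x y hx hxy hy =>
        binomialLower_symm_antitone (by
          have : ((2 * ⌊α * (n + 1)⌋₊ : ℕ) : ℝ) ≤ (n + 1 : ℕ) := by
            push_cast
            nlinarith
          exact_mod_cast this) hx hxy hy) hε] with J hJ
    rw [integral_binomialLower (floor_mul_add_one_le_nat hα.le hα1.le n)] at hJ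
    have : (⌊α * (n + 1)⌋₊ : ℝ) / (n + 1) ≤ α := (div_le_iff₀ hn).2 hfl
    linarith
  filter_upwards [hlarge, hsmall] with J hl hsm
  rcases lt_or_ge (M J) N with hM | hM
  · exact hsm _ (Finset.mem_range.2 hM)
  · have hM' : 1 / δ ^ 3 ≤ (M J : ℝ) := hN.trans (by exact_mod_cast hM)
    have hmono := integral_mono (μ := designLaw (p J)) .of_finite .of_finite
      fun z => binomialLower_floor_le_ramp hα.le hα1.le hδ hM'
        (q := tailProb (p J) (observe (a J) (b J) z) (tReg (p J) (observe (a J) (b J) z) z))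
        measureReal_nonneg measureReal_le_one
    rw [integral_add .of_finite .of_finite, integral_const, probReal_univ, one_smul] at hmono
    linarith [integral_ramp_le hδ (by linarith : 0 ≤ α + 2 * δ) hδ1]

end RegularArray

theorem WeakNullAsymptotics.limsup_pValue_le {m : ℕ} {pmin : ℝ} {p : (J : ℕ) → Fin J → I}
    {Y : (J : ℕ) → PotentialOutcomes (J * L)} {ν : Measure (ℝ × ℝ × ℝ)}
    (h : WeakNullAsymptotics L m pmin p Y ν) (hna : ∀ J, NonAnticipating (Y J))
    (hcarry : ∀ J, MCarryover m (Y J)) (hup : 0 < sigmaUpReg ν)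
    (hnull : ∀ J : ℕ, focalEffect m (Y J) = 0) (M : ℕ → ℕ) {α : ℝ} (hα : 0 < α)
    (hs : (sigmaReg ν = sigmaUpReg ν ∧ α < 1) ∨ α < 1 / 2) :
    limsup (fun J : ℕ => monteCarloLaw (M J) (p J)
      {ω | pValue m (p J) (Y J) ω.1 ω.2 ≤ α}) atTop ≤ ENNReal.ofReal α := by
  obtain ⟨C, hC⟩ := h.exists_regularArray hnull
  refine ENNReal.le_of_forall_pos_le_add fun ε hε _ => ?_
  refine limsup_le_of_le (by isBoundedDefault) ?_
  filter_upwards [hC.eventually_integral_binomialLower_le hup hα hs M (ε := ε)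
    (by exact_mod_cast hε)] with J hJ
  rw [monteCarloLaw_pValue_le m (p J) (Y J) hα.le]
  simp only [observedMean_eq (hna J) (hcarry J)]
  refine (ENNReal.ofReal_le_ofReal hJ).trans ?_
  exact ENNReal.ofReal_add_le.trans_eq (by rw [ENNReal.ofReal_coe_nnreal])

end Switchback

theorem corollary1 (L m : ℕ) (pmin : ℝ) (p : (J : ℕ) → Fin J → unitInterval)
    (Y : (J : ℕ) → Switchback.PotentialOutcomes (J * L))
    (ν : MeasureTheory.Measure (ℝ × ℝ × ℝ))
    (hna : ∀ J : ℕ, Switchback.NonAnticipating (Y J))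
    (hcarry : ∀ J : ℕ, Switchback.MCarryover m (Y J))
    (hasymp : Switchback.WeakNullAsymptotics L m pmin p Y ν)
    (hnondeg : 0 < Switchback.sigmaUpReg ν)
    (hnull : ∀ J : ℕ, Switchback.focalEffect m (Y J) = 0)
    (M : ℕ → ℕ) :
    (∀ α : ℝ, 0 < α → α < 1 / 2 →
      Filter.limsup (fun J : ℕ => Switchback.monteCarloLaw (M J) (p J)
        {ω | Switchback.pValue m (p J) (Y J) ω.1 ω.2 ≤ α}) Filter.atTop ≤ ENNReal.ofReal α) ∧
    (Switchback.sigmaReg ν = Switchback.sigmaUpReg ν → ∀ α : ℝ, 0 < α → α < 1 →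
      Filter.limsup (fun J : ℕ => Switchback.monteCarloLaw (M J) (p J)
        {ω | Switchback.pValue m (p J) (Y J) ω.1 ω.2 ≤ α}) Filter.atTop ≤ ENNReal.ofReal α) :=
  ⟨fun _ h0 h1 => hasymp.limsup_pValue_le hna hcarry hnondeg hnull M h0 (.inr h1),
    fun hs _ h0 h1 => hasymp.limsup_pValue_le hna hcarry hnondeg hnull M h0 (.inl ⟨hs, h1⟩)⟩
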